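/- Let $(X_j)_{j\ge 0}$ be a stationary standard Gaussian process (jointly Gaussian, strictly stationary, $\mathbb E X_j=0$, $\operatorname{Var}X_j=1$) whose autocovariance function satisfies $$r(k)=\operatorname{Cov}(X_0,X_k)=L(k)\,k^{-D},\qquad k\ge 1,$$ where $0<D<1$ and $L$ is slowly varying at infinity, i.e. $L$ is measurable and positive on some half-line $[A,\infty)$ and $L(\lambda x)/L(x)\to 1$ as $x\to\infty$ for every $\lambda>0$. Let $p\in\mathbb N$ and let $f:\mathbb R^p\to\mathbb R$ be a measurable function with $\mathbb E\, f(X_1,\dots,X_p)^2<\infty$ and with Hermite rank $1$ with respect to the law of $(X_1,\dots,X_p)$; here the Hermite rank is the smallest total degree $l_1+\dots+l_p$ $(l_i\ge 0)$ such that $$\mathbb E\Big[\big(f(X_1,\dots,X_p)-\mathbb E f(X_1,\dots,X_p)\big)\prod_{i=1}^p H_{l_i}(X_i)\Big]\ne 0,\qquad H_k(x)=(-1)^k e^{x^2/2}\frac{d^k}{dx^k}e^{-x^2/2}.$$ Then the covariance matrix $\Sigma_p=(\operatorname{Cov}(X_i,X_j))_{1\le i,j\le p}$ is invertible and, as $n\to\infty$,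 $$\frac{1}{n^{1-D/2}L(n)^{1/2}}\sum_{i=1}^n\big(f(X_i,\dots,X_{i+p-1})-\mathbb E f(X_1,\dots,X_p)\big)\longrightarrow \mathcal N\Big(0,\;c_D\Big(\sum_{j=1}^p\alpha_j\Big)^2\Big)\quad\text{in distribution},$$ where $$c_D=\frac{2}{(1-D)(2-D)},\qquad \alpha=(\alpha_1,\dots,\alpha_p)^t=\Sigma_p^{-1}c,\qquad c=(c_1,\dots,c_p)^t,\quad c_k=\mathbb E\big[f(X_1,\dots,X_p)\,X_k\big].$$ If $\sum_{j}\alpha_j=0$ the limit is the point mass at $0$. -/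

import Mathlib

open MeasureTheory ProbabilityTheory Filter Topology

noncomputable section

/-- `L` is slowly varying at infinity: it is measurable and positive on some half-line `[A, ∞)`,
and `L (c x) / L x → 1` as `x → ∞`, for every `c > 0`. -/
structure IsSlowlyVarying (L : ℝ → ℝ) : Prop where
  exists_pos_measurable :
    ∃ A : ℝ, (∀ x, A ≤ x → 0 < L x) ∧ Measurable (fun x : Set.Ici A => L x)
  tendsto_ratio : ∀ c : ℝ, 0 < c → Tendsto (fun x => L (c * x) / L x) atTop (𝓝 1)

/-- The process `X = (X_j)_{j ≥ 0}` is (strictly) stationary under `P`: every shifted process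
`(X_{j+h})_{j ≥ 0}` has the same law on the sequence space as `X`. -/
def IsStationaryProcess {Ω : Type*} [MeasurableSpace Ω] (X : ℕ → Ω → ℝ) (P : Measure Ω) : Prop :=
  ∀ h : ℕ, IdentDistrib (fun ω (j : ℕ) => X (j + h) ω) (fun ω (j : ℕ) => X j ω) P P

/-- `X` is a stationary standard Gaussian process under `P`. -/
structure IsStationaryStdGaussian {Ω : Type*} [MeasurableSpace Ω] (X : ℕ → Ω → ℝ)
    (P : Measure Ω) : Prop where
  gaussian : IsGaussianProcess X P
  stationary : IsStationaryProcess X P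
  mean_zero : ∀ j, ∫ ω, X j ω ∂P = 0
  var_one : ∀ j, Var[X j; P] = 1

/-- The overlapping block `(X_i, X_{i+1}, …, X_{i+p-1})`. -/
def block {Ω : Type*} (X : ℕ → Ω → ℝ) (p i : ℕ) (ω : Ω) : Fin p → ℝ :=
  fun j => X (i + j) ω

/-- The covariance matrix `Σ_p` of `(X_1, …, X_p)`. -/
def blockCov {Ω : Type*} [MeasurableSpace Ω] (X : ℕ → Ω → ℝ) (P : Measure Ω) (p : ℕ) :
    Matrix (Fin p) (Fin p) ℝ :=
  Matrix.of fun i j => cov[X (1 + i), X (1 + j); P]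

/-- The multivariate Hermite polynomial `H_{l_1,…,l_p}(x) = ∏ i, H_{l_i}(x_i)`, built from the
probabilists' Hermite polynomials `H_k(x) = (-1)^k exp(x²/2) (d/dx)^k exp(-x²/2)`. -/
def mvHermite {p : ℕ} (l : Fin p → ℕ) (x : Fin p → ℝ) : ℝ :=
  ∏ i, Polynomial.aeval (x i) (Polynomial.hermite (l i))

/-- The Hermite rank of `G` with respect to the law `μ` on `ℝ^p` (in practice `μ = N(0, Σ)`): the
least total degree `l_1 + ⋯ + l_p` for which the centred function `G - ∫ G dμ` has
`∫ (G - ∫ G dμ) H_{l_1,…,l_p} dμ ≠ 0`. It is `⊤` if there is no such multi-index. -/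
def hermiteRank {p : ℕ} (G : (Fin p → ℝ) → ℝ) (μ : Measure (Fin p → ℝ)) : ℕ∞ :=
  sInf {m : ℕ∞ | ∃ l : Fin p → ℕ,
    m = ((∑ i, l i : ℕ) : ℕ∞) ∧ ∫ x, (G x - ∫ y, G y ∂μ) * mvHermite l x ∂μ ≠ 0}

/-- The vector `c = E[f(X_1, …, X_p) (X_1, …, X_p)^t]`. -/
def firstOrderCoeff {Ω : Type*} [MeasurableSpace Ω] (X : ℕ → Ω → ℝ) (P : Measure Ω) {p : ℕ}
    (f : (Fin p → ℝ) → ℝ) : Fin p → ℝ :=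
  fun j => ∫ ω, f (block X p 1 ω) * X (1 + j) ω ∂P

/-- The vector `α = Σ_p⁻¹ c`. -/
def alphaVec {Ω : Type*} [MeasurableSpace Ω] (X : ℕ → Ω → ℝ) (P : Measure Ω) {p : ℕ}
    (f : (Fin p → ℝ) → ℝ) : Fin p → ℝ :=
  Matrix.mulVec (blockCov X P p)⁻¹ (firstOrderCoeff X P f)

/-- The normalized partial sum
`n^{-(1 - D/2)} L(n)^{-1/2} ∑_{i=1}^n (f(X_i, …, X_{i+p-1}) - E f(X_1, …, X_p))`. -/
def normalizedSum {Ω : Type*} [MeasurableSpace Ω] (X : ℕ → Ω → ℝ) (P : Measure Ω) {p : ℕ}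
    (f : (Fin p → ℝ) → ℝ) (L : ℝ → ℝ) (D : ℝ) (n : ℕ) (ω : Ω) : ℝ :=
  ((n : ℝ) ^ (1 - D / 2) * √(L n))⁻¹ *
    ∑ i ∈ Finset.Icc 1 n, (f (block X p i ω) - ∫ ω', f (block X p 1 ω') ∂P)

end

/-! Write `f - E f = α ⬝ᵥ x + g`. Since `Σ_p α = c`, the linear form is the L² projection of `f - E
f` onto the span of the coordinates, so `g` is orthogonal to constants and coordinates. Only the
linear part survives the normalization.

Sums of the linear part are exactly Gaussian, so only their variance matters. The lag-`k` covariance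
of the linear part, divided by `r(k)`, tends to `(∑ α_j)²`, and Karamata's theorem
(`tendsto_sum_range_div`), used twice in `tendsto_sum_sum_dist_div`, produces the factor `c_D`.

The covariances of `g` are `O(r(k)²) = o(r(k))`, so the same variance computation gives limit `0`
and Slutsky's theorem concludes. This quadratic bound (`abs_integral_mul_le_of_gaussian_pair`) is
proved on characters instead of Hermite polynomials. For whitened blocks with cross-covariance `R`,
the cross Gram matrix of normalized characters is `exp (aᵀ R b)`, while their own Gram matrix is
`exp (aᵀ b)`. In the exponential series, the degree-`m` part of the latter is a sum of squares, and
it dominates the degree-`m` part of the former with factor `(p δ)^m`, where `δ` bounds the entries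
of `R`. Orthogonality to constants and coordinates removes degrees `0` and `1`, which leaves `(p
δ)²`; density of the characters in L² gives all `g`.

Whitening needs `Σ_p` invertible. Otherwise stationarity would confine the whole process to a
finite-dimensional subspace of L², where `r(k) → 0` is incompatible with unit variance. -/

/-! ### Powers and exponentials of bilinear forms -/

open scoped InnerProductSpace ComplexConjugate in
/-- Expansion of a power of a bilinear form over words of length `m`. -/
lemma dotProduct_mulVec_pow {ι : Type*} [Fintype ι] (R : Matrix ι ι ℝ) (x y : ι → ℝ) (m : ℕ) :
    (x ⬝ᵥ R.mulVec y) ^ m =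
      ∑ v : Fin m → ι × ι, (∏ k, R (v k).1 (v k).2) * (∏ k, x (v k).1) * ∏ k, y (v k).2 := by
  have h : x ⬝ᵥ R.mulVec y = ∑ w : ι × ι, R w.1 w.2 * x w.1 * y w.2 := by
    simp only [dotProduct, Matrix.mulVec, Finset.mul_sum, Fintype.sum_prod_type]
    exact Finset.sum_congr rfl fun i _ => Finset.sum_congr rfl fun j _ => by ring
  rw [h, Fintype.sum_pow]
  simp only [Finset.prod_mul_distrib]

-- The kernel `(x ⬝ᵥ y) ^ m` is the Gram kernel of the `m`-th tensor powers, so its quadratic form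
-- is a sum of squares indexed by words of length `m`. This supplies the nonnegative quantity
-- against which the `R`-form is compared.
open scoped ComplexConjugate in
lemma sum_conj_mul_dotProduct_pow {ι κ : Type*} [Fintype ι] (s : Finset κ) (d : κ → ℂ)
    (x : κ → ι → ℝ) (m : ℕ) :
    ∑ a ∈ s, ∑ b ∈ s, conj (d b) * d a * ((x a ⬝ᵥ x b : ℝ) : ℂ) ^ m =
      ((∑ v : Fin m → ι, ‖∑ a ∈ s, d a * ((∏ k, x a (v k) : ℝ) : ℂ)‖ ^ 2 : ℝ) : ℂ) := by
  have h (a b : κ) : ((x a ⬝ᵥ x b : ℝ) : ℂ) ^ m =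
      ∑ v : Fin m → ι, ((∏ k, x a (v k) : ℝ) : ℂ) * ((∏ k, x b (v k) : ℝ) : ℂ) := by
    rw [dotProduct, ← Complex.ofReal_pow, Fintype.sum_pow]
    push_cast [Finset.prod_mul_distrib]
    rfl
  push_cast
  simp_rw [h, ← Complex.conj_mul', map_sum, Finset.sum_mul_sum, Finset.mul_sum]
  rw [Finset.sum_comm' (t' := s) (s' := fun _ => s) (by simp)]
  simp_rw [Finset.sum_comm (s := s) (t := Finset.univ)]
  refine Finset.sum_congr rfl fun v _ => Finset.sum_congr rfl fun b _ =>
    Finset.sum_congr rfl fun a _ => ?_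
  simp only [map_mul, map_prod, Complex.conj_ofReal, Complex.ofReal_prod]
  ring

open scoped ComplexConjugate in
/-- If the entries of `R` are at most `δ`, then the `m`-th power of the form `R`, tested against
any weights, is dominated by `(p δ) ^ m` times the `m`-th power of the Euclidean form. -/
lemma norm_sum_conj_mul_pow_le {ι κ : Type*} [Fintype ι] (s : Finset κ) (d : κ → ℂ)
    (x : κ → ι → ℝ) (R : Matrix ι ι ℝ) {δ : ℝ} (hδ : 0 ≤ δ)
    (hR : ∀ i j, |R i j| ≤ δ) (m : ℕ) :
    ‖∑ a ∈ s, ∑ b ∈ s, conj (d b) * d a * ((x a ⬝ᵥ R.mulVec (x b) : ℝ) : ℂ) ^ m‖ ≤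
      (Fintype.card ι * δ) ^ m *
        ∑ v : Fin m → ι, ‖∑ a ∈ s, d a * ((∏ k, x a (v k) : ℝ) : ℂ)‖ ^ 2 := by
  set T : (Fin m → ι) → ℂ := fun v => ∑ a ∈ s, d a * ((∏ k, x a (v k) : ℝ) : ℂ) with hT
  have h1 : ∑ a ∈ s, ∑ b ∈ s, conj (d b) * d a * ((x a ⬝ᵥ R.mulVec (x b) : ℝ) : ℂ) ^ m =
      ∑ v : Fin m → ι × ι, ((∏ k, R (v k).1 (v k).2 : ℝ) : ℂ) *
        (T (fun k => (v k).1) * conj (T (fun k => (v k).2))) := by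
    simp_rw [← Complex.ofReal_pow, dotProduct_mulVec_pow, hT, map_sum, Finset.sum_mul_sum,
      Complex.ofReal_sum, Finset.mul_sum]
    simp_rw [Finset.sum_comm (s := s) (t := Finset.univ)]
    refine Finset.sum_congr rfl fun v _ => Finset.sum_congr rfl fun a _ =>
      Finset.sum_congr rfl fun b _ => ?_
    simp only [map_mul, Complex.conj_ofReal]
    push_cast
    ring
  have hprod (v : Fin m → ι × ι) : ‖((∏ k, R (v k).1 (v k).2 : ℝ) : ℂ)‖ ≤ δ ^ m := by
    rw [Complex.norm_real, Real.norm_eq_abs, Finset.abs_prod]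
    calc ∏ k, |R (v k).1 (v k).2| ≤ ∏ _k : Fin m, δ :=
          Finset.prod_le_prod (fun _ _ => abs_nonneg _) fun k _ => hR _ _
      _ = δ ^ m := by simp
  rw [h1]
  calc ‖∑ v : Fin m → ι × ι, ((∏ k, R (v k).1 (v k).2 : ℝ) : ℂ) *
        (T (fun k => (v k).1) * conj (T (fun k => (v k).2)))‖
      ≤ ∑ v : Fin m → ι × ι, δ ^ m * (‖T (fun k => (v k).1)‖ * ‖T (fun k => (v k).2)‖) := by
        refine (norm_sum_le _ _).trans (Finset.sum_le_sum fun v _ => ?_)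
        rw [norm_mul, norm_mul, RCLike.norm_conj]
        exact mul_le_mul_of_nonneg_right (hprod v) (by positivity)
    -- A word of pairs is a pair of words, so the sum factors. Cauchy–Schwarz over the `p ^ m`
    -- words, with `p = card ι`, then accounts for the factor `p ^ m`.
    _ = δ ^ m * (∑ v : Fin m → ι, ‖T v‖) ^ 2 := by
        rw [← Finset.mul_sum, sq, Finset.sum_mul_sum, ← Fintype.sum_prod_type']
        congr 1
        exact Fintype.sum_equiv (Equiv.arrowProdEquivProdArrow _ _ _) _ _ fun v => rfl
    _ ≤ δ ^ m * (Fintype.card (Fin m → ι) * ∑ v : Fin m → ι, ‖T v‖ ^ 2) := by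
        exact mul_le_mul_of_nonneg_left
          (by simpa using sq_sum_le_card_mul_sum_sq (s := Finset.univ) (f := fun v => ‖T v‖))
          (pow_nonneg hδ m)
    _ = _ := by
        simp only [Fintype.card_pi, Finset.prod_const, Finset.card_univ, Fintype.card_fin]
        rw [Nat.cast_pow, mul_pow]
        ring

lemma Complex.hasSum_pow_div_factorial (z : ℂ) :
    HasSum (fun m : ℕ => z ^ m / (m.factorial : ℂ)) (Complex.exp z) := by
  rw [Complex.exp_eq_exp_ℂ]
  exact NormedSpace.expSeries_div_hasSum_exp z

-- The two exponential series are compared degree by degree. Subtracting `1` and the linear term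
-- leaves degrees `m + 2`, where `(p δ) ^ (m + 2) ≤ (p δ) ^ 2` because `p δ ≤ 1`. On the right, the
-- missing degrees `0` and `1` are nonnegative and may be added back.
open scoped ComplexConjugate in
lemma norm_sum_conj_mul_exp_sub_le {ι κ : Type*} [Fintype ι] (s : Finset κ) (d : κ → ℂ)
    (x : κ → ι → ℝ) (R : Matrix ι ι ℝ) {δ : ℝ} (hδ : 0 ≤ δ) (hR : ∀ i j, |R i j| ≤ δ)
    (hδ1 : Fintype.card ι * δ ≤ 1) :
    ‖∑ a ∈ s, ∑ b ∈ s, conj (d b) * d a * (Complex.exp (x a ⬝ᵥ R.mulVec (x b) : ℝ) - 1 -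
        (x a ⬝ᵥ R.mulVec (x b) : ℝ))‖ ≤
      (Fintype.card ι * δ) ^ 2 *
        (∑ a ∈ s, ∑ b ∈ s, conj (d b) * d a * Complex.exp (x a ⬝ᵥ x b : ℝ)).re := by
  set Q : ℕ → ℝ := fun m =>
    ∑ v : Fin m → ι, ‖∑ a ∈ s, d a * ((∏ k, x a (v k) : ℝ) : ℂ)‖ ^ 2 with hQ
  have hQ0 (m : ℕ) : 0 ≤ Q m := Finset.sum_nonneg fun v _ => by positivity
  have hsum : HasSum (fun m : ℕ => Q m / m.factorial)
      (∑ a ∈ s, ∑ b ∈ s, conj (d b) * d a * Complex.exp (x a ⬝ᵥ x b : ℝ)).re := by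
    have h := hasSum_sum (s := s) fun a _ => hasSum_sum (s := s) fun b _ =>
      (Complex.hasSum_pow_div_factorial ((x a ⬝ᵥ x b : ℝ) : ℂ)).mul_left (conj (d b) * d a)
    convert Complex.hasSum_re h using 2 with m
    have h1 : ∑ a ∈ s, ∑ b ∈ s, conj (d b) * d a *
        (((x a ⬝ᵥ x b : ℝ) : ℂ) ^ m / (m.factorial : ℂ)) = ((Q m / m.factorial : ℝ) : ℂ) := by
      rw [Complex.ofReal_div, hQ, ← sum_conj_mul_dotProduct_pow]
      simp only [Finset.sum_div, mul_div_assoc, Complex.ofReal_natCast]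
    rw [h1, Complex.ofReal_re]
  have hsum2 : HasSum (fun m : ℕ => ∑ a ∈ s, ∑ b ∈ s, conj (d b) * d a *
        (((x a ⬝ᵥ R.mulVec (x b) : ℝ) : ℂ) ^ (m + 2) / ((m + 2).factorial : ℂ)))
      (∑ a ∈ s, ∑ b ∈ s, conj (d b) * d a * (Complex.exp (x a ⬝ᵥ R.mulVec (x b) : ℝ) - 1 -
        (x a ⬝ᵥ R.mulVec (x b) : ℝ))) := by
    refine hasSum_sum fun a _ => hasSum_sum fun b _ => HasSum.mul_left _ ?_
    have h := (hasSum_nat_add_iff' 2).mpr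
      (Complex.hasSum_pow_div_factorial ((x a ⬝ᵥ R.mulVec (x b) : ℝ) : ℂ))
    simpa only [Finset.sum_range_succ, Finset.sum_range_zero, pow_zero, Nat.factorial_zero,
      Nat.cast_one, div_one, zero_add, pow_one, Nat.factorial_one, ← sub_sub] using h
  have hsum3 := (summable_nat_add_iff 2).mpr hsum.summable
  refine (hsum2.norm_le_of_bounded (hsum3.hasSum.mul_left ((Fintype.card ι * δ) ^ 2))
    fun m => ?_).trans ?_
  · have h1 : ∑ a ∈ s, ∑ b ∈ s, conj (d b) * d a *
        (((x a ⬝ᵥ R.mulVec (x b) : ℝ) : ℂ) ^ (m + 2) / ((m + 2).factorial : ℂ)) =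
        (∑ a ∈ s, ∑ b ∈ s, conj (d b) * d a *
        ((x a ⬝ᵥ R.mulVec (x b) : ℝ) : ℂ) ^ (m + 2)) / ((m + 2).factorial : ℂ) := by
      simp only [Finset.sum_div, mul_div_assoc]
    rw [h1, norm_div, Complex.norm_natCast, mul_div_assoc']
    refine div_le_div_of_nonneg_right ?_ (by positivity)
    refine (norm_sum_conj_mul_pow_le s d x R hδ hR (m + 2)).trans ?_
    refine mul_le_mul_of_nonneg_right ?_ (hQ0 _)
    exact pow_le_pow_of_le_one (by positivity) hδ1 (by omega)
  · refine mul_le_mul_of_nonneg_left ?_ (by positivity)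
    rw [← hsum.tsum_eq]
    rw [← hsum.summable.sum_add_tsum_nat_add 2]
    exact le_add_of_nonneg_left (Finset.sum_nonneg fun m _ => by have := hQ0 m; positivity)

/-! ### The second-order Gebelein inequality in Hilbert space -/

open scoped InnerProductSpace ComplexConjugate in
/-- A family `e` of vectors with the Gram matrix of normalised exponentials, mapped by two
isometries so that the cross Gram matrix is `exp (aᵀ R b)`: on the closed span of `e`, on vectors
orthogonal to the constant `e 0` and to the coordinates `ξ i`, the cross form is at most
`(p δ) ^ 2` times the square norm, where `δ` bounds the entries of `R`. -/
lemma norm_inner_map_map_le_of_exp_gram {ι H H' : Type*} [Fintype ι]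
    [NormedAddCommGroup H] [InnerProductSpace ℂ H] [NormedAddCommGroup H'] [InnerProductSpace ℂ H']
    (e : (ι → ℝ) → H) (ξ : ι → H) (J₁ J₂ : H →ₗᵢ[ℂ] H') (R : Matrix ι ι ℝ) {δ : ℝ} (hδ : 0 ≤ δ)
    (hR : ∀ i j, |R i j| ≤ δ) (hδ1 : Fintype.card ι * δ ≤ 1)
    (he : ∀ a b, ⟪e b, e a⟫_ℂ = Complex.exp ((-(a ⬝ᵥ a) / 2 + -(b ⬝ᵥ b) / 2 + a ⬝ᵥ b : ℝ)))
    (hξ : ∀ i a, ⟪ξ i, e a⟫_ℂ = Complex.I * a i * Complex.exp ((-(a ⬝ᵥ a) / 2 : ℝ)))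
    (hJ : ∀ a b, ⟪J₂ (e b), J₁ (e a)⟫_ℂ =
      Complex.exp ((-(a ⬝ᵥ a) / 2 + -(b ⬝ᵥ b) / 2 + a ⬝ᵥ R.mulVec b : ℝ)))
    {F : H} (hF : F ∈ (Submodule.span ℂ (Set.range e)).topologicalClosure)
    (hF0 : ⟪e 0, F⟫_ℂ = 0) (hF1 : ∀ i, ⟪ξ i, F⟫_ℂ = 0) :
    ‖⟪J₂ F, J₁ F⟫_ℂ‖ ≤ (Fintype.card ι * δ) ^ 2 * ‖F‖ ^ 2 := by
  -- Elements of the span need not be orthogonal to `e 0` and `ξ i`, so the degree `0` and `1`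
  -- contributions are subtracted explicitly. The resulting inequality is a closed condition and
  -- need only be checked on finite combinations.
  have key : ∀ G ∈ (Submodule.span ℂ (Set.range e)).topologicalClosure,
      ‖⟪J₂ G, J₁ G⟫_ℂ - conj ⟪e 0, G⟫_ℂ * ⟪e 0, G⟫_ℂ -
        ∑ i, ∑ j, R i j * (conj ⟪ξ j, G⟫_ℂ * ⟪ξ i, G⟫_ℂ)‖ ≤
      (Fintype.card ι * δ) ^ 2 * ‖G‖ ^ 2 := by
    intro G hG
    have hclosed : IsClosed {G : H | ‖⟪J₂ G, J₁ G⟫_ℂ - conj ⟪e 0, G⟫_ℂ * ⟪e 0, G⟫_ℂ -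
        ∑ i, ∑ j, R i j * (conj ⟪ξ j, G⟫_ℂ * ⟪ξ i, G⟫_ℂ)‖ ≤
        (Fintype.card ι * δ) ^ 2 * ‖G‖ ^ 2} := by
      refine isClosed_le ?_ (by fun_prop)
      have h1 := J₁.continuous
      have h2 := J₂.continuous
      have h3 : Continuous (conj : ℂ → ℂ) := Complex.continuous_conj
      fun_prop
    refine closure_minimal (fun G hG => ?_) hclosed hG
    obtain ⟨c, rfl⟩ := (Finsupp.mem_span_range_iff_exists_finsupp).mp hG
    simp only [Finsupp.sum, Set.mem_ofPred_eq]
    set s := c.support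
    -- Absorbing the Gaussian factors into the coefficients reduces the Gram kernels to `exp (a ⬝ᵥ
    -- b)` and `exp (a ⬝ᵥ R b)`.
    set d : (ι → ℝ) → ℂ := fun a => c a * Complex.exp ((-(a ⬝ᵥ a) / 2 : ℝ)) with hd
    have hconj (a : ι → ℝ) : conj (d a) = conj (c a) * Complex.exp ((-(a ⬝ᵥ a) / 2 : ℝ)) := by
      simp only [hd, map_mul, ← Complex.exp_conj, Complex.conj_ofReal]
    have e0 : ⟪e 0, ∑ a ∈ s, c a • e a⟫_ℂ = ∑ a ∈ s, d a := by
      simp [he, hd]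
    have eξ (i : ι) : ⟪ξ i, ∑ a ∈ s, c a • e a⟫_ℂ = ∑ a ∈ s, Complex.I * (d a * a i) := by
      rw [inner_sum]
      refine Finset.sum_congr rfl fun a _ => ?_
      rw [inner_smul_right, hξ, hd]
      ring
    have eJ : ⟪J₂ (∑ a ∈ s, c a • e a), J₁ (∑ a ∈ s, c a • e a)⟫_ℂ =
        ∑ a ∈ s, ∑ b ∈ s, conj (d b) * d a * Complex.exp (a ⬝ᵥ R.mulVec b : ℝ) := by
      simp only [map_sum, map_smul, inner_sum, sum_inner, inner_smul_left, inner_smul_right, hJ]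
      refine Finset.sum_congr rfl fun a _ => ?_
      rw [Finset.mul_sum]
      refine Finset.sum_congr rfl fun b _ => ?_
      rw [Complex.ofReal_add, Complex.ofReal_add, Complex.exp_add, Complex.exp_add, hconj]
      simp only [hd]
      ring
    have en : ‖∑ a ∈ s, c a • e a‖ ^ 2 =
        (∑ a ∈ s, ∑ b ∈ s, conj (d b) * d a * Complex.exp (a ⬝ᵥ b : ℝ)).re := by
      have h := inner_self_eq_norm_sq_to_K (𝕜 := ℂ) (∑ a ∈ s, c a • e a)
      have h2 : ⟪∑ a ∈ s, c a • e a, ∑ a ∈ s, c a • e a⟫_ℂ =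
          ∑ a ∈ s, ∑ b ∈ s, conj (d b) * d a * Complex.exp (a ⬝ᵥ b : ℝ) := by
        simp only [inner_sum, sum_inner, inner_smul_left, inner_smul_right, he]
        refine Finset.sum_congr rfl fun a _ => ?_
        rw [Finset.mul_sum]
        refine Finset.sum_congr rfl fun b _ => ?_
        rw [Complex.ofReal_add, Complex.ofReal_add, Complex.exp_add, Complex.exp_add, hconj]
        simp only [hd]
        ring
      rw [← h2, h]
      norm_cast
    rw [en]
    refine le_trans (le_of_eq ?_)
      (norm_sum_conj_mul_exp_sub_le s d (fun a => a) R hδ hR hδ1)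
    congr 1
    rw [eJ, e0]
    simp_rw [eξ]
    simp only [mul_sub, Finset.sum_sub_distrib]
    congr 1
    · congr 1
      rw [map_sum, Finset.sum_mul_sum, Finset.sum_comm]
      simp
    · have h1 (a b : ι → ℝ) : conj (d b) * d a * ((a ⬝ᵥ R.mulVec b : ℝ) : ℂ) =
          ∑ i, ∑ j, R i j * (conj (Complex.I * (d b * b j)) * (Complex.I * (d a * a i))) := by
        simp only [dotProduct, Matrix.mulVec, Complex.ofReal_sum, Complex.ofReal_mul,
          Finset.mul_sum, map_mul, Complex.conj_ofReal, Complex.conj_I]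
        refine Finset.sum_congr rfl fun i _ => Finset.sum_congr rfl fun j _ => ?_
        linear_combination ((R i j * conj (d b) * d a * a i * b j : ℂ)) * Complex.I_mul_I
      simp_rw [h1, map_sum, Finset.sum_mul_sum, Finset.mul_sum]
      simp_rw [Finset.sum_comm (s := s) (t := Finset.univ)]
      exact Finset.sum_congr rfl fun i _ => Finset.sum_congr rfl fun j _ => Finset.sum_comm
  have h := key F hF
  simpa [hF0, hF1] using h

/-! ### Density of characters and the inequality for Gaussian pairs -/

/-- An integrable function all of whose Fourier integrals vanish is zero almost everywhere. -/
lemma ae_eq_zero_of_forall_integral_mul_exp_eq_zero {E : Type*} [NormedAddCommGroup E]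
    [NormedSpace ℝ E] [MeasurableSpace E] [BorelSpace E] [SecondCountableTopology E]
    [CompleteSpace E] {μ : Measure E} {h : E → ℝ} (hh : Integrable h μ)
    (h0 : ∀ T : StrongDual ℝ E, ∫ x, (h x : ℂ) * Complex.exp (T x * Complex.I) ∂μ = 0) :
    h =ᵐ[μ] 0 := by
  have := isFiniteMeasure_withDensity_ofReal hh.2
  have := isFiniteMeasure_withDensity_ofReal hh.neg.2
  have hm1 : AEMeasurable (fun x => ENNReal.ofReal (h x)) μ := hh.1.aemeasurable.ennreal_ofReal
  have hm2 : AEMeasurable (fun x => ENNReal.ofReal ((-h) x)) μ :=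
    hh.neg.1.aemeasurable.ennreal_ofReal
  -- The positive and negative parts of `h` are densities of finite measures with the same
  -- characteristic function, hence of the same measure.
  have key : μ.withDensity (fun x => ENNReal.ofReal (h x)) =
      μ.withDensity (fun x => ENNReal.ofReal ((-h) x)) := by
    refine Measure.ext_of_charFunDual (funext fun T => ?_)
    have hi {u : E → ℝ} (hu : Integrable u μ) :
        Integrable (fun x => (u x : ℂ) * Complex.exp (T x * Complex.I)) μ := by
      refine hu.ofReal.mul_bdd (c := 1) (by fun_prop) (ae_of_all _ fun x => ?_)
      rw [Complex.norm_exp_ofReal_mul_I]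
    rw [charFunDual_apply, charFunDual_apply,
      integral_withDensity_eq_integral_toReal_smul₀ hm1 (by simp),
      integral_withDensity_eq_integral_toReal_smul₀ hm2 (by simp), ← sub_eq_zero]
    simp only [ENNReal.toReal_ofReal', Pi.neg_apply, Complex.real_smul]
    have hi2 := hi hh.neg.pos_part
    simp only [Pi.neg_apply] at hi2
    rw [← integral_sub (hi hh.pos_part) hi2, ← h0 T]
    refine integral_congr_ae (ae_of_all _ fun x => ?_)
    simp only [← sub_mul, ← Complex.ofReal_sub, max_zero_sub_max_neg_zero_eq_self]
  rw [withDensity_eq_iff hm1 hm2 hh.lintegral_lt_top.ne] at key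
  filter_upwards [key] with x hx
  simp only [Pi.neg_apply] at hx
  rcases le_total 0 (h x) with h1 | h1
  · rw [ENNReal.ofReal_of_nonpos (by linarith : -h x ≤ 0), ENNReal.ofReal_eq_zero] at hx
    exact le_antisymm hx h1
  · rw [ENNReal.ofReal_of_nonpos h1, eq_comm, ENNReal.ofReal_eq_zero] at hx
    exact le_antisymm h1 (neg_nonpos.mp hx)

lemma continuous_exp_dotProduct_mul_I {ι : Type*} [Fintype ι] (a : ι → ℝ) :
    Continuous fun x : ι → ℝ => Complex.exp ((a ⬝ᵥ x : ℝ) * Complex.I) := by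
  unfold dotProduct
  fun_prop

/-- The character `x ↦ exp (i a·x)` as an element of `L²(μ)`. -/
noncomputable def charLp {ι : Type*} [Fintype ι] (μ : Measure (ι → ℝ)) [IsProbabilityMeasure μ]
    (a : ι → ℝ) : Lp ℂ 2 μ :=
  MemLp.toLp (fun x => Complex.exp ((a ⬝ᵥ x : ℝ) * Complex.I))
    (MemLp.of_bound (continuous_exp_dotProduct_mul_I _).aestronglyMeasurable 1
      (ae_of_all _ fun _ => (Complex.norm_exp_ofReal_mul_I _).le))

lemma coeFn_charLp {ι : Type*} [Fintype ι] (μ : Measure (ι → ℝ)) [IsProbabilityMeasure μ]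
    (a : ι → ℝ) : charLp μ a =ᵐ[μ] fun x => Complex.exp ((a ⬝ᵥ x : ℝ) * Complex.I) :=
  MemLp.coeFn_toLp _

-- A function orthogonal to all characters has vanishing Fourier integrals, and so does its
-- conjugate. Its real and imaginary parts then vanish by uniqueness of the Fourier transform.
open scoped InnerProductSpace ComplexConjugate in
lemma topologicalClosure_span_charLp {ι : Type*} [Fintype ι] (μ : Measure (ι → ℝ))
    [IsProbabilityMeasure μ] :
    (Submodule.span ℂ (Set.range (charLp μ))).topologicalClosure = ⊤ := by
  rw [Submodule.topologicalClosure_eq_top_iff, Submodule.eq_bot_iff]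
  intro F hF
  have hFi : Integrable F μ := (Lp.memLp F).integrable (by norm_num)
  have h1 (a : ι → ℝ) : ∫ x, F x * Complex.exp ((a ⬝ᵥ x : ℝ) * Complex.I) ∂μ = 0 := by
    -- The inner product conjugates its first argument, hence the character of `-a`.
    have h := (Submodule.mem_orthogonal _ _).mp hF _
      (Submodule.subset_span (Set.mem_range_self (-a)))
    rw [L2.inner_def] at h
    rw [← h]
    refine integral_congr_ae ?_
    filter_upwards [coeFn_charLp μ (-a)] with x hx
    rw [hx, RCLike.inner_apply, ← Complex.exp_conj]
    simp
  have h2 (a : ι → ℝ) : ∫ x, conj (F x) * Complex.exp ((a ⬝ᵥ x : ℝ) * Complex.I) ∂μ = 0 := by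
    refine Eq.trans ?_ ((congrArg conj (h1 (-a))).trans (map_zero _))
    rw [← integral_conj]
    refine integral_congr_ae (ae_of_all _ fun x => ?_)
    simp [← Complex.exp_conj]
  have hb (G : (ι → ℝ) → ℂ) (hG : Integrable G μ) (a : ι → ℝ) :
      Integrable (fun x => G x * Complex.exp ((a ⬝ᵥ x : ℝ) * Complex.I)) μ := by
    refine hG.mul_bdd (c := 1)
      (continuous_exp_dotProduct_mul_I _).aestronglyMeasurable (ae_of_all _ fun x => ?_)
    rw [Complex.norm_exp_ofReal_mul_I]
  have hdual (T : StrongDual ℝ (ι → ℝ)) : ∃ a : ι → ℝ, ∀ x, T x = a ⬝ᵥ x := by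
    classical
    refine ⟨fun i => T fun j => if i = j then 1 else 0, fun x => ?_⟩
    have := LinearMap.pi_apply_eq_sum_univ T.toLinearMap x
    simpa [dotProduct, mul_comm] using this
  have hFc : Integrable (fun x => conj (F x)) μ := by
    refine (integrable_norm_iff ?_).mp ?_
    · exact Complex.continuous_conj.comp_aestronglyMeasurable hFi.1
    · simpa using hFi.norm
  have hre : (fun x => (F x).re) =ᵐ[μ] 0 := by
    refine ae_eq_zero_of_forall_integral_mul_exp_eq_zero hFi.re fun T => ?_
    obtain ⟨a, ha⟩ := hdual T
    have h : ∫ x, (F x * Complex.exp ((a ⬝ᵥ x : ℝ) * Complex.I) +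
        conj (F x) * Complex.exp ((a ⬝ᵥ x : ℝ) * Complex.I)) / 2 ∂μ = 0 := by
      rw [integral_div, integral_add (hb _ hFi a) (hb _ hFc a), h1, h2]
      simp
    rw [← h]
    refine integral_congr_ae (ae_of_all _ fun x => ?_)
    simp only [ha, Complex.re_eq_add_conj]
    ring
  have him : (fun x => (F x).im) =ᵐ[μ] 0 := by
    refine ae_eq_zero_of_forall_integral_mul_exp_eq_zero hFi.im fun T => ?_
    obtain ⟨a, ha⟩ := hdual T
    have h : ∫ x, (F x * Complex.exp ((a ⬝ᵥ x : ℝ) * Complex.I) -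
        conj (F x) * Complex.exp ((a ⬝ᵥ x : ℝ) * Complex.I)) / (2 * Complex.I) ∂μ = 0 := by
      rw [integral_div, integral_sub (hb _ hFi a) (hb _ hFc a), h1, h2]
      simp
    rw [← h]
    refine integral_congr_ae (ae_of_all _ fun x => ?_)
    simp only [ha, Complex.im_eq_sub_conj]
    ring
  rw [Lp.eq_zero_iff_ae_eq_zero]
  filter_upwards [hre, him] with x hx hy
  exact Complex.ext hx hy

lemma hasDerivAt_integral_exp_add_mul {α : Type*} [MeasurableSpace α] {μ : Measure α}
    [IsFiniteMeasure μ] {u v : α → ℝ} (hu : AEStronglyMeasurable u μ) (hv : Integrable v μ) :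
    HasDerivAt (fun t : ℝ => ∫ x, Complex.exp ((u x + t * v x : ℝ) * Complex.I) ∂μ)
      (∫ x, Complex.exp ((u x : ℝ) * Complex.I) * ((v x : ℂ) * Complex.I) ∂μ) 0 := by
  have hc (t : ℝ) :
      AEStronglyMeasurable (fun x => Complex.exp ((u x + t * v x : ℝ) * Complex.I)) μ :=
    (by fun_prop : Continuous fun r : ℝ => Complex.exp (r * Complex.I)).comp_aestronglyMeasurable
      (hu.add (hv.1.const_mul t))
  have hv2 : AEStronglyMeasurable (fun x => (v x : ℂ) * Complex.I) μ :=
    (by fun_prop : Continuous fun r : ℝ => (r : ℂ) * Complex.I).comp_aestronglyMeasurable hv.1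
  have h := (hasDerivAt_integral_of_dominated_loc_of_deriv_le (μ := μ) (𝕜 := ℝ) (x₀ := 0)
    (s := Set.univ) (bound := fun x => |v x|)
    (F := fun t x => Complex.exp ((u x + t * v x : ℝ) * Complex.I))
    (F' := fun t x => Complex.exp ((u x + t * v x : ℝ) * Complex.I) * ((v x : ℂ) * Complex.I))
    univ_mem (Eventually.of_forall hc)
    (Integrable.of_bound (hc 0) 1 (ae_of_all _ fun x => (Complex.norm_exp_ofReal_mul_I _).le))
    ((hc 0).mul hv2) ?_ hv.abs ?_).2
  · simpa using h
  · refine ae_of_all _ fun x t _ => ?_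
    rw [norm_mul, Complex.norm_exp_ofReal_mul_I, one_mul, norm_mul, Complex.norm_I, mul_one,
      Complex.norm_real, Real.norm_eq_abs]
  · refine ae_of_all _ fun x t _ => ?_
    have h1 : HasDerivAt (fun t : ℝ => u x + t * v x) (v x) t := by
      simpa using ((hasDerivAt_id t).mul_const (v x)).const_add (u x)
    exact (h1.ofReal_comp.mul_const Complex.I).cexp

/-- First moments of a standard Gaussian vector against characters. -/
lemma integral_mul_exp_of_integral_exp {ι : Type*} [Fintype ι] {μ : Measure (ι → ℝ)}
    [IsProbabilityMeasure μ] {i : ι} (hi : Integrable (fun x => x i) μ)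
    (h : ∀ a : ι → ℝ, ∫ x, Complex.exp ((a ⬝ᵥ x : ℝ) * Complex.I) ∂μ =
      Complex.exp ((-(a ⬝ᵥ a) / 2 : ℝ))) (a : ι → ℝ) :
    ∫ x, Complex.exp ((a ⬝ᵥ x : ℝ) * Complex.I) * (x i : ℂ) ∂μ =
      Complex.I * a i * Complex.exp ((-(a ⬝ᵥ a) / 2 : ℝ)) := by
  classical
  have hm : Continuous fun x : ι → ℝ => a ⬝ᵥ x := by
    unfold dotProduct
    fun_prop
  have hd1 := hasDerivAt_integral_exp_add_mul (hm.aestronglyMeasurable (μ := μ)) hi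
  -- Perturbing `a` in direction `i` makes the characteristic function explicit in `t`; the two
  -- expressions for its derivative at `0` are then equated.
  have h2 (t : ℝ) : ∫ x, Complex.exp ((a ⬝ᵥ x + t * x i : ℝ) * Complex.I) ∂μ =
      Complex.exp ((-(a ⬝ᵥ a) / 2 - t * a i - t ^ 2 / 2 : ℝ)) := by
    have h3 := h (a + Pi.single i t)
    have h4 : -((a + Pi.single i t) ⬝ᵥ (a + Pi.single i t)) / 2 =
        -(a ⬝ᵥ a) / 2 - t * a i - t ^ 2 / 2 := by
      simp [add_dotProduct, dotProduct_add]
      ring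
    rw [h4] at h3
    rw [← h3]
    simp [add_dotProduct]
  simp_rw [h2] at hd1
  have hd2 : HasDerivAt (fun t : ℝ =>
      Complex.exp ((-(a ⬝ᵥ a) / 2 - t * a i - t ^ 2 / 2 : ℝ)))
      (Complex.exp ((-(a ⬝ᵥ a) / 2 : ℝ)) * (-a i : ℝ)) 0 := by
    have h5 := (((hasDerivAt_id (0 : ℝ)).mul_const (a i)).const_sub (-(a ⬝ᵥ a) / 2)).sub
      (((hasDerivAt_id (0 : ℝ)).pow 2).div_const 2)
    have h6 := h5.ofReal_comp.cexp
    simpa using h6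
  have h7 := hd1.unique hd2
  simp only [← mul_assoc] at h7
  rw [integral_mul_const] at h7
  have h8 := congrArg (fun z => z * (-Complex.I)) h7
  simp only [Complex.ofReal_neg] at h8
  linear_combination h8 + (∫ x, Complex.exp ((a ⬝ᵥ x : ℝ) * Complex.I) * (x i : ℂ) ∂μ) *
    Complex.I_mul_I

open scoped InnerProductSpace ComplexConjugate in
/-- The Gebelein inequality of order two: if `κ` is the law of a pair of standard Gaussian vectors
whose cross-covariance matrix `R` has entries at most `δ`, then for `g` orthogonal to constants and
coordinates, the covariance of `g` at the two vectors is at most `(p δ) ^ 2` times the variance. -/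
lemma abs_integral_mul_le_of_gaussian_pair {ι : Type*} [Fintype ι] {μ : Measure (ι → ℝ)}
    [IsProbabilityMeasure μ] {κ : Measure ((ι → ℝ) × (ι → ℝ))}
    (hfst : MeasurePreserving Prod.fst κ μ) (hsnd : MeasurePreserving Prod.snd κ μ)
    (R : Matrix ι ι ℝ) {δ : ℝ} (hδ : 0 ≤ δ) (hR : ∀ i j, |R i j| ≤ δ)
    (hδ1 : Fintype.card ι * δ ≤ 1)
    (hchar : ∀ a b : ι → ℝ, ∫ z, Complex.exp ((a ⬝ᵥ z.1 - b ⬝ᵥ z.2 : ℝ) * Complex.I) ∂κ =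
      Complex.exp ((-(a ⬝ᵥ a) / 2 + -(b ⬝ᵥ b) / 2 + a ⬝ᵥ R.mulVec b : ℝ)))
    (hmem : ∀ i, MemLp (fun x : ι → ℝ => x i) 2 μ)
    {g : (ι → ℝ) → ℝ} (hg : MemLp g 2 μ) (hg0 : ∫ x, g x ∂μ = 0)
    (hg1 : ∀ i, ∫ x, g x * x i ∂μ = 0) :
    |∫ z, g z.1 * g z.2 ∂κ| ≤ (Fintype.card ι * δ) ^ 2 * ∫ x, g x ^ 2 ∂μ := by
  have hchar1 (a : ι → ℝ) : ∫ x, Complex.exp ((a ⬝ᵥ x : ℝ) * Complex.I) ∂μ =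
      Complex.exp ((-(a ⬝ᵥ a) / 2 : ℝ)) := by
    have h := hchar a 0
    simp only [zero_dotProduct, sub_zero, neg_zero, zero_div, add_zero, Matrix.mulVec_zero,
      dotProduct_zero] at h
    rw [← h, ← hfst.map_eq, integral_map hfst.aemeasurable
      (continuous_exp_dotProduct_mul_I _).aestronglyMeasurable]
  set J₁ := Lp.compMeasurePreservingₗᵢ (E := ℂ) (p := 2) ℂ Prod.fst hfst with hJ₁
  set J₂ := Lp.compMeasurePreservingₗᵢ (E := ℂ) (p := 2) ℂ Prod.snd hsnd with hJ₂
  have cJ₁ (F : Lp ℂ 2 μ) : J₁ F =ᵐ[κ] fun z => F z.1 := Lp.coeFn_compMeasurePreserving F hfst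
  have cJ₂ (F : Lp ℂ 2 μ) : J₂ F =ᵐ[κ] fun z => F z.2 := Lp.coeFn_compMeasurePreserving F hsnd
  set ξ : ι → Lp ℂ 2 μ := fun i => (hmem i).ofReal.toLp with hξ
  have cξ (i : ι) : ξ i =ᵐ[μ] fun x => (x i : ℂ) := MemLp.coeFn_toLp (hmem i).ofReal
  set G : Lp ℂ 2 μ := hg.ofReal.toLp with hG
  have cG : G =ᵐ[μ] fun x => (g x : ℂ) := MemLp.coeFn_toLp hg.ofReal
  have h := norm_inner_map_map_le_of_exp_gram (charLp μ) ξ J₁ J₂ R hδ hR hδ1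
    (fun a b => ?_) (fun i a => ?_) (fun a b => ?_) (F := G)
    (by rw [topologicalClosure_span_charLp]; trivial) ?_ (fun i => ?_)
  · have h1 : ⟪J₂ G, J₁ G⟫_ℂ = ((∫ z, g z.1 * g z.2 ∂κ : ℝ) : ℂ) := by
      rw [L2.inner_def, ← integral_complex_ofReal]
      refine integral_congr_ae ?_
      filter_upwards [cJ₁ G, cJ₂ G, hfst.quasiMeasurePreserving.ae cG,
        hsnd.quasiMeasurePreserving.ae cG] with z h1 h2 h3 h4
      rw [h1, h2, h3, h4, RCLike.inner_apply, Complex.conj_ofReal, Complex.ofReal_mul]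
    have h2 : ‖G‖ ^ 2 = ∫ x, g x ^ 2 ∂μ := by
      have h3 := inner_self_eq_norm_sq_to_K (𝕜 := ℂ) G
      rw [L2.inner_def] at h3
      have h4 : ∫ x, ⟪G x, G x⟫_ℂ ∂μ = ((∫ x, g x ^ 2 ∂μ : ℝ) : ℂ) := by
        rw [← integral_complex_ofReal]
        refine integral_congr_ae ?_
        filter_upwards [cG] with x hx
        rw [hx, RCLike.inner_apply, Complex.conj_ofReal, Complex.ofReal_pow, sq]
      rw [h4] at h3
      refine Complex.ofReal_injective (Eq.trans ?_ h3.symm)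
      push_cast
      rfl
    rwa [h1, h2, Complex.norm_real, Real.norm_eq_abs] at h
  · rw [L2.inner_def]
    have h2 := hchar1 (a - b)
    have h3 : -((a - b) ⬝ᵥ (a - b)) / 2 = -(a ⬝ᵥ a) / 2 + -(b ⬝ᵥ b) / 2 + a ⬝ᵥ b := by
      rw [sub_dotProduct, dotProduct_sub, dotProduct_sub, dotProduct_comm b a]
      ring
    rw [← h3, ← h2]
    refine integral_congr_ae ?_
    filter_upwards [coeFn_charLp μ a, coeFn_charLp μ b] with x ha hb
    rw [ha, hb, RCLike.inner_apply, ← Complex.exp_conj, ← Complex.exp_add, sub_dotProduct]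
    simp only [map_mul, Complex.conj_ofReal, Complex.conj_I, Complex.ofReal_sub]
    ring_nf
  · rw [L2.inner_def, ← integral_mul_exp_of_integral_exp ((hmem i).integrable (by norm_num)) hchar1]
    refine integral_congr_ae ?_
    filter_upwards [coeFn_charLp μ a, cξ i] with x ha hb
    rw [ha, hb, RCLike.inner_apply, Complex.conj_ofReal]
  · rw [L2.inner_def, ← hchar]
    refine integral_congr_ae ?_
    filter_upwards [cJ₁ (charLp μ a), cJ₂ (charLp μ b),
      hfst.quasiMeasurePreserving.ae (coeFn_charLp μ a),
      hsnd.quasiMeasurePreserving.ae (coeFn_charLp μ b)] with z h1 h2 h3 h4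
    rw [h1, h2, h3, h4, RCLike.inner_apply, ← Complex.exp_conj, ← Complex.exp_add]
    simp only [map_mul, Complex.conj_ofReal, Complex.conj_I, Complex.ofReal_sub]
    ring_nf
  · rw [L2.inner_def]
    have h1 : ∫ x, ((g x : ℝ) : ℂ) ∂μ = 0 := by rw [integral_complex_ofReal, hg0]; simp
    rw [← h1]
    refine integral_congr_ae ?_
    filter_upwards [cG, coeFn_charLp μ 0] with x ha hb
    rw [ha, hb, RCLike.inner_apply]
    simp
  · rw [L2.inner_def]
    have h1 : ∫ x, ((g x * x i : ℝ) : ℂ) ∂μ = 0 := by rw [integral_complex_ofReal, hg1]; simp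
    rw [← h1]
    refine integral_congr_ae ?_
    filter_upwards [cG, cξ i] with x ha hb
    rw [ha, hb, RCLike.inner_apply, Complex.conj_ofReal, Complex.ofReal_mul]

/-! ### Uniform convergence for slowly varying functions -/

/-- The uniform convergence theorem for additively slowly varying functions. -/
lemma exists_forall_abs_add_sub_lt {h : ℝ → ℝ} (hm : Measurable h)
    (hlim : ∀ u, Tendsto (fun x => h (x + u) - h x) atTop (𝓝 0)) {ε : ℝ} (hε : 0 < ε) :
    ∃ B : ℝ, ∀ x, B ≤ x → ∀ u ∈ Set.Icc (0 : ℝ) 2, |h (x + u) - h x| < ε := by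
  by_contra! hcon
  choose x hx u hu hbad using fun n : ℕ => hcon n
  have hxt : Tendsto x atTop atTop := tendsto_atTop_mono hx tendsto_natCast_atTop_atTop
  have hyt : Tendsto (fun n => x n + u n) atTop atTop :=
    tendsto_atTop_mono (fun n => le_add_of_nonneg_right (hu n).1) hxt
  -- Pointwise convergence implies convergence in measure on `[0, 4]`, so the exceptional set
  -- eventually has measure below `1`. It is applied at the base points `x n` and `x n + u n`.
  have key {y : ℕ → ℝ} (hy : Tendsto y atTop atTop) :
      ∀ᶠ n in atTop, volume ({t | ε / 2 ≤ |h (y n + t) - h (y n)|} ∩ Set.Icc 0 4) < 1 := by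
    have h1 : TendstoInMeasure (volume.restrict (Set.Icc (0 : ℝ) 4))
        (fun n t => h (y n + t) - h (y n)) atTop (fun _ => 0) :=
      tendstoInMeasure_of_tendsto_ae (fun n => by
        have : Measurable fun t => h (y n + t) - h (y n) :=
          (hm.comp (measurable_const_add _)).sub_const _
        exact this.aestronglyMeasurable)
        (ae_of_all _ fun t => (hlim t).comp hy)
    rw [tendstoInMeasure_iff_norm] at h1
    filter_upwards [(h1 (ε / 2) (by positivity)).eventually_lt_const zero_lt_one] with n hn
    rw [Measure.restrict_apply' measurableSet_Icc] at hn
    simpa using hn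
  obtain ⟨n, hn1, hn2⟩ := ((key hxt).and (key hyt)).exists
  set S := {t | ε / 2 ≤ |h (x n + t) - h (x n)|} ∩ Set.Icc 0 4
  set T := {t | ε / 2 ≤ |h (x n + u n + t) - h (x n + u n)|} ∩ Set.Icc 0 4
  obtain ⟨hu0, hu2⟩ := hu n
  -- The interval has length at least `2`, while the two exceptional sets have total measure below
  -- `2`. A point `t` outside both gives `h (x n + t)` as an intermediate value within `ε / 2` of
  -- `h` at each base point.
  have hsub : ¬ Set.Icc (u n) 4 ⊆ S ∪ (fun t => t + -u n) ⁻¹' T := by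
    intro hsub
    have h1 := (measure_mono hsub).trans (measure_union_le (μ := volume) _ _)
    rw [measure_preimage_add_right, Real.volume_Icc] at h1
    have h2 : (2 : ENNReal) ≤ ENNReal.ofReal (4 - u n) := by
      rw [← ENNReal.ofReal_ofNat]
      exact ENNReal.ofReal_le_ofReal (by linarith)
    have h3 := (h2.trans h1).trans_lt (ENNReal.add_lt_add hn1 hn2)
    norm_num at h3
  obtain ⟨t, ⟨ht1, ht2⟩, ht⟩ := Set.not_subset.mp hsub
  simp only [S, T, Set.mem_union, Set.mem_inter_iff, Set.mem_ofPred_eq, Set.mem_Icc,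
    Set.mem_preimage, not_or, not_and, not_le] at ht
  have h1 : |h (x n + t) - h (x n)| < ε / 2 := by
    by_contra! hc
    linarith [ht.1 hc (by linarith)]
  have h2 : |h (x n + t) - h (x n + u n)| < ε / 2 := by
    by_contra! hc
    have h3 := ht.2 (by rwa [show x n + u n + (t + -u n) = x n + t by ring]) (by linarith)
    linarith
  refine absurd (hbad n) (not_le.mpr ?_)
  calc |h (x n + u n) - h (x n)| = |(h (x n + t) - h (x n)) - (h (x n + t) - h (x n + u n))| := by
        ring_nf
    _ ≤ |h (x n + t) - h (x n)| + |h (x n + t) - h (x n + u n)| := abs_sub _ _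
    _ < ε := by linarith

namespace IsSlowlyVarying

variable {L : ℝ → ℝ}

lemma eventually_pos (hL : IsSlowlyVarying L) : ∀ᶠ n : ℕ in atTop, 0 < L n := by
  obtain ⟨A, hA, -⟩ := hL.exists_pos_measurable
  filter_upwards [tendsto_natCast_atTop_atTop.eventually_ge_atTop A] with n hn using hA _ hn

/-- The uniform convergence theorem for slowly varying functions. -/
lemma exists_forall_abs_log_sub_lt (hL : IsSlowlyVarying L) {ε : ℝ} (hε : 0 < ε) :
    ∃ B : ℝ, 0 < B ∧ ∀ x y, B ≤ x → x ≤ y → y ≤ 4 * x →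
      0 < L x ∧ 0 < L y ∧ |Real.log (L y) - Real.log (L x)| < ε := by
  obtain ⟨A, hA, hmeas⟩ := hL.exists_pos_measurable
  -- `L` is only known to be measurable on `[A, ∞)`; `M` is measurable everywhere and agrees with
  -- `L` there.
  set M : ℝ → ℝ := fun x => L (max x A)
  have hM : Measurable M :=
    hmeas.comp (g := fun x : Set.Ici A => L x)
      (f := fun x : ℝ => (⟨max x A, Set.mem_Ici.mpr (le_max_right _ _)⟩ : Set.Ici A))
      (Measurable.subtype_mk (by fun_prop))
  have hML {x : ℝ} (hx : A ≤ x) : M x = L x := by simp [M, hx]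
  set h : ℝ → ℝ := fun x => Real.log (M (Real.exp x))
  have hh : Measurable h := Real.measurable_log.comp (hM.comp Real.measurable_exp)
  have hlim (u : ℝ) : Tendsto (fun x => h (x + u) - h x) atTop (𝓝 0) := by
    have h1 := ((hL.tendsto_ratio (Real.exp u) (Real.exp_pos u)).comp
      Real.tendsto_exp_atTop).log one_ne_zero
    rw [Real.log_one] at h1
    refine h1.congr' ?_
    filter_upwards [Real.tendsto_exp_atTop.eventually_ge_atTop A,
      (Real.tendsto_exp_atTop.comp (tendsto_atTop_add_const_right _ u tendsto_id)).eventually_ge_atTop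
        A] with x hx1 hx2
    simp only [Function.comp_apply, id] at hx2
    simp only [h, Function.comp_apply]
    rw [hML hx1, hML hx2, mul_comm, ← Real.exp_add,
      Real.log_div (hA _ hx2).ne' (hA _ hx1).ne']
  obtain ⟨B, hB⟩ := exists_forall_abs_add_sub_lt hh hlim hε
  refine ⟨max A (Real.exp B), lt_max_of_lt_right (Real.exp_pos B), fun x y hx hxy hyx => ?_⟩
  have hxA : A ≤ x := (le_max_left _ _).trans hx
  have hxB : Real.exp B ≤ x := (le_max_right _ _).trans hx
  have hx0 : 0 < x := (Real.exp_pos B).trans_le hxB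
  have hy0 : 0 < y := hx0.trans_le hxy
  -- The window `[0, 2]` for the additive increment therefore covers ratios `y / x` up to `4`.
  have h4 : Real.log 4 ≤ 2 := by
    rw [show (4 : ℝ) = 2 ^ 2 by norm_num, Real.log_pow]
    have := Real.log_two_lt_d9
    push_cast
    linarith
  have hlog : Real.log y ≤ Real.log x + 2 := by
    have := Real.log_le_log hy0 hyx
    rw [Real.log_mul (by norm_num) hx0.ne'] at this
    linarith
  have h1 := hB (Real.log x) ((Real.le_log_iff_exp_le hx0).mpr hxB) (Real.log y - Real.log x)
    ⟨by linarith [Real.log_le_log hx0 hxy], by linarith⟩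
  simp only [h, add_sub_cancel, Real.exp_log hx0, Real.exp_log hy0, hML hxA,
    hML (hxA.trans hxy)] at h1
  exact ⟨hA _ hxA, hA _ (hxA.trans hxy), h1⟩

/-- Along integers, `L k / L n` is uniformly close to `1` for `n / 4 ≤ k ≤ 4 n`. -/
lemma exists_forall_abs_div_sub_one_le (hL : IsSlowlyVarying L) {ε : ℝ} (hε : 0 < ε) :
    ∃ N : ℕ, ∀ n k : ℕ, N ≤ n → k ≤ 4 * n → n ≤ 4 * k → |L k / L n - 1| ≤ ε := by
  have hcont : Tendsto Real.exp (𝓝 0) (𝓝 1) := by simpa using Real.continuous_exp.tendsto 0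
  obtain ⟨η, hη, hexp⟩ := Metric.tendsto_nhds_nhds.mp hcont ε hε
  obtain ⟨B, hB0, hB⟩ := hL.exists_forall_abs_log_sub_lt hη
  refine ⟨⌈4 * B⌉₊, fun n k hn hkn hnk => ?_⟩
  have hn4 : 4 * B ≤ n := Nat.ceil_le.mp hn
  have hkn' : (k : ℝ) ≤ 4 * n := by exact_mod_cast hkn
  have hnk' : (n : ℝ) ≤ 4 * k := by exact_mod_cast hnk
  obtain ⟨h1, h2, h3⟩ : 0 < L k ∧ 0 < L n ∧ |Real.log (L k) - Real.log (L n)| < η := by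
    rcases le_total (n : ℝ) k with h | h
    · obtain ⟨h1, h2, h3⟩ := hB n k (by linarith) h hkn'
      exact ⟨h2, h1, h3⟩
    · obtain ⟨h1, h2, h3⟩ := hB k n (by linarith) h hnk'
      exact ⟨h1, h2, by rwa [abs_sub_comm]⟩
  have h4 := hexp (x := Real.log (L k) - Real.log (L n)) (by rwa [Real.dist_eq, sub_zero])
  rw [Real.exp_sub, Real.exp_log h1, Real.exp_log h2, Real.dist_eq] at h4
  exact h4.le

lemma tendsto_div_of_le (hL : IsSlowlyVarying L) {k : ℕ → ℕ} (h1 : ∀ᶠ n in atTop, k n ≤ 4 * n)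
    (h2 : ∀ᶠ n in atTop, n ≤ 4 * k n) : Tendsto (fun n : ℕ => L (k n) / L n) atTop (𝓝 1) := by
  rw [Metric.tendsto_nhds]
  intro ε hε
  obtain ⟨N, hN⟩ := hL.exists_forall_abs_div_sub_one_le (half_pos hε)
  filter_upwards [h1, h2, eventually_ge_atTop N] with n h1 h2 h3
  rw [Real.dist_eq]
  linarith [hN n (k n) h3 h1 h2]

end IsSlowlyVarying

/-! ### Karamata's theorem by halving -/

/-- A sequence that satisfies `e n ≤ q n * e (n / 2) + b n` with `q n → q < 1` and `b n → 0`
tends to zero. -/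
lemma tendsto_zero_of_le_mul_half_add {e q b : ℕ → ℝ} {r : ℝ} (he : ∀ n, 0 ≤ e n)
    (hq : Tendsto q atTop (𝓝 r)) (hr : r < 1) (hb : Tendsto b atTop (𝓝 0))
    (hle : ∀ᶠ n in atTop, e n ≤ q n * e (n / 2) + b n) : Tendsto e atTop (𝓝 0) := by
  obtain ⟨s, hrs, hs1⟩ := exists_between (max_lt hr zero_lt_one)
  have hs0 : 0 < s := (le_max_right _ _).trans_lt hrs
  have key (ε : ℝ) (hε : 0 < ε) : ∀ᶠ n in atTop, e n ≤ 2 * ε := by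
    -- The map `x ↦ s x + ε (1 - s)` has fixed point `ε`, so each halving multiplies a bound on the
    -- excess over `ε` by `s`.
    have hev : ∀ᶠ n in atTop, e n ≤ s * e (n / 2) + ε * (1 - s) := by
      filter_upwards [hle, hq.eventually_le_const ((le_max_left _ _).trans_lt hrs),
        hb.eventually_le_const (show 0 < ε * (1 - s) by nlinarith)] with n h1 h2 h3
      nlinarith [mul_le_mul_of_nonneg_right h2 (he (n / 2))]
    obtain ⟨N, hN⟩ := eventually_atTop.mp hev
    set M := ∑ k ∈ Finset.range (N + 1), e k with hM
    have hM0 : 0 ≤ M := Finset.sum_nonneg fun k _ => he k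
    have bound (n : ℕ) : e n ≤ M + ε := by
      induction n using Nat.strong_induction_on with
      | _ n ih =>
        rcases le_or_gt n N with h | h
        · have := Finset.single_le_sum (f := e) (fun k _ => he k)
            (Finset.mem_range.mpr (Nat.lt_succ_of_le h))
          linarith
        · have h1 := hN n h.le
          have h2 := ih (n / 2) (by omega)
          nlinarith
    have decay (j : ℕ) : ∀ n, (N + 1) * 2 ^ j ≤ n → e n ≤ M * s ^ j + ε := by
      induction j with
      | zero => intro n _; simpa using bound n
      | succ j ih =>
        intro n hn
        have h0 : (N + 1) * 2 ^ j * 2 ≤ n := by rw [pow_succ] at hn; linarith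
        have h1 := ih (n / 2) ((Nat.le_div_iff_mul_le two_pos).mpr h0)
        have h2 := hN n (by nlinarith [Nat.one_le_two_pow (n := j)])
        rw [pow_succ]
        nlinarith
    have hpow : Tendsto (fun j : ℕ => M * s ^ j) atTop (𝓝 0) := by
      simpa using (tendsto_pow_atTop_nhds_zero_of_lt_one hs0.le hs1).const_mul M
    obtain ⟨j, hj⟩ := (hpow.eventually_le_const hε).exists
    filter_upwards [eventually_ge_atTop ((N + 1) * 2 ^ j)] with n hn
    linarith [decay j n hn]
  rw [Metric.tendsto_atTop]
  intro ε hε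
  obtain ⟨N, hN⟩ := eventually_atTop.mp (key (ε / 3) (by positivity))
  refine ⟨N, fun n hn => ?_⟩
  rw [Real.dist_eq, sub_zero, abs_of_nonneg (he n)]
  linarith [hN n hn]

lemma tendsto_natCast_half_div : Tendsto (fun n : ℕ => ((n / 2 : ℕ) : ℝ) / n) atTop (𝓝 2⁻¹) := by
  have h := (tendsto_nat_floor_mul_div_atTop (R := ℝ) (a := 2⁻¹) (by norm_num)).comp
    tendsto_natCast_atTop_atTop
  refine h.congr fun n => ?_
  simp only [Function.comp_apply]
  rw [show (2⁻¹ : ℝ) * n = (n : ℝ) / ((2 : ℕ) : ℝ) by push_cast; ring, Nat.floor_div_natCast,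
    Nat.floor_natCast]

lemma tendsto_half_rpow_div (γ : ℝ) :
    Tendsto (fun n : ℕ => ((n / 2 : ℕ) : ℝ) ^ γ / (n : ℝ) ^ γ) atTop (𝓝 ((2⁻¹ : ℝ) ^ γ)) := by
  refine (tendsto_natCast_half_div.rpow_const (p := γ) (Or.inl (by norm_num))).congr fun n => ?_
  rw [Real.div_rpow (by positivity) (by positivity)]

/-- The increments of `k ^ (β + 1)` telescope and are asymptotic to `(β + 1) k ^ β`, by the
derivative of the power function at `1`. Little-o relations can be summed because the telescoped
sums diverge. -/
lemma tendsto_sum_range_rpow_div {β : ℝ} (hβ : -1 < β) :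
    Tendsto (fun n : ℕ => (∑ k ∈ Finset.range n, (k : ℝ) ^ β) / (n : ℝ) ^ (β + 1)) atTop
      (𝓝 (β + 1)⁻¹) := by
  have hγ : 0 < β + 1 := by linarith
  set g : ℕ → ℝ := fun k => ((k + 1 : ℕ) : ℝ) ^ (β + 1) - (k : ℝ) ^ (β + 1) with hg
  have hg0 (k : ℕ) : 0 ≤ g k := sub_nonneg.mpr
    (Real.rpow_le_rpow (by positivity) (by push_cast; linarith) hγ.le)
  have hsum (n : ℕ) : ∑ k ∈ Finset.range n, g k = (n : ℝ) ^ (β + 1) := by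
    rw [Finset.sum_range_sub (fun k : ℕ => (k : ℝ) ^ (β + 1))]
    simp [Real.zero_rpow hγ.ne']
  have hratio : Tendsto (fun k : ℕ => g k / (k : ℝ) ^ β) atTop (𝓝 (β + 1)) := by
    have hd := ((Real.hasDerivAt_rpow_const (x := 1) (p := β + 1)
      (Or.inl one_ne_zero))).tendsto_slope_zero
    have hk : Tendsto (fun k : ℕ => ((k : ℝ))⁻¹) atTop (𝓝[≠] 0) := by
      refine tendsto_nhdsWithin_iff.mpr ⟨tendsto_inv_atTop_zero.comp tendsto_natCast_atTop_atTop, ?_⟩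
      filter_upwards [eventually_gt_atTop 0] with k hk
      simp [hk.ne']
    have h := hd.comp hk
    simp only [Real.one_rpow, mul_one] at h
    refine h.congr' ?_
    filter_upwards [eventually_gt_atTop 0] with k hk
    have hk' : (0 : ℝ) < k := by exact_mod_cast hk
    have h1 : 1 + (k : ℝ)⁻¹ = ((k + 1 : ℕ) : ℝ) / k := by
      push_cast
      field_simp
    simp only [Function.comp_apply, hg, smul_eq_mul, inv_inv]
    rw [h1, Real.div_rpow (by positivity) hk'.le, Real.rpow_add_one hk'.ne' β]
    have := (Real.rpow_pos_of_pos hk' β).ne'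
    field_simp
  have hlo : (fun k : ℕ => (k : ℝ) ^ β - (β + 1)⁻¹ * g k) =o[atTop] g := by
    have hne : ∀ᶠ k in atTop, g k ≠ 0 := by
      filter_upwards [hratio.eventually_ne hγ.ne'] with k hk h0
      simp [h0] at hk
    refine (Asymptotics.isLittleO_iff_tendsto' (hne.mono fun k hk h => absurd h hk)).mpr ?_
    have h1 := (hratio.inv₀ hγ.ne').sub_const (β + 1)⁻¹
    rw [sub_self] at h1
    refine h1.congr' ?_
    filter_upwards [hne] with k hk
    rw [inv_div, sub_div, mul_div_cancel_right₀ _ hk]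
  have hS := hlo.sum_range hg0 (by
    simp_rw [hsum]
    exact (tendsto_rpow_atTop hγ).comp tendsto_natCast_atTop_atTop)
  simp_rw [Finset.sum_sub_distrib, ← Finset.mul_sum, hsum] at hS
  have h2 := hS.tendsto_div_nhds_zero.add_const (β + 1)⁻¹
  rw [zero_add] at h2
  refine h2.congr' ?_
  filter_upwards [eventually_gt_atTop 0] with n hn
  have hn' : (0 : ℝ) < n := by exact_mod_cast hn
  rw [sub_div, mul_div_cancel_right₀ _ (Real.rpow_pos_of_pos hn' _).ne', sub_add_cancel]

lemma tendsto_sum_Ico_half_rpow_div {β : ℝ} (hβ : -1 < β) :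
    Tendsto (fun n : ℕ => (∑ k ∈ Finset.Ico (n / 2) n, (k : ℝ) ^ β) / (n : ℝ) ^ (β + 1)) atTop
      (𝓝 ((1 - 2⁻¹ ^ (β + 1)) / (β + 1))) := by
  have h1 := tendsto_sum_range_rpow_div hβ
  have hhalf : Tendsto (fun n : ℕ => n / 2) atTop atTop := Nat.tendsto_div_const_atTop two_ne_zero
  have h2 := h1.sub ((h1.comp hhalf).mul (tendsto_half_rpow_div (β + 1)))
  have h3 : (β + 1)⁻¹ - (β + 1)⁻¹ * 2⁻¹ ^ (β + 1) = (1 - 2⁻¹ ^ (β + 1)) / (β + 1) := by ring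
  rw [h3] at h2
  refine h2.congr' ?_
  filter_upwards [hhalf.eventually_gt_atTop 0] with n hn
  have hn' : (0 : ℝ) < (n / 2 : ℕ) := by exact_mod_cast hn
  have h4 := (Real.rpow_pos_of_pos hn' (β + 1)).ne'
  simp only [Function.comp_apply]
  rw [Finset.sum_Ico_eq_sub _ (Nat.div_le_self n 2), sub_div, div_mul_div_cancel₀ h4]

namespace IsSlowlyVarying

variable {L : ℝ → ℝ}

lemma tendsto_half_weight (hL : IsSlowlyVarying L) (γ : ℝ) :
    Tendsto (fun n : ℕ => (((n / 2 : ℕ) : ℝ) ^ γ * L (n / 2 : ℕ)) / ((n : ℝ) ^ γ * L n)) atTop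
      (𝓝 (2⁻¹ ^ γ)) := by
  have h1 := hL.tendsto_div_of_le (k := fun n => n / 2)
    (Eventually.of_forall fun n => by omega)
    (by filter_upwards [eventually_ge_atTop 2] with n hn; omega)
  have h2 := (tendsto_half_rpow_div γ).mul h1
  rw [mul_one] at h2
  exact h2.congr fun n => by rw [div_mul_div_comm]

/-- Karamata's theorem for sums of regularly varying sequences of index `β > -1`. -/
lemma tendsto_sum_range_div (hL : IsSlowlyVarying L) {β c : ℝ} (hβ : -1 < β) {a : ℕ → ℝ}
    (ha : Tendsto (fun n : ℕ => a n / ((n : ℝ) ^ β * L n)) atTop (𝓝 c)) :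
    Tendsto (fun n : ℕ => (∑ k ∈ Finset.range n, a k) / ((n : ℝ) ^ (β + 1) * L n)) atTop
      (𝓝 (c / (β + 1))) := by
  have hγ : 0 < β + 1 := by linarith
  set q : ℝ := 2⁻¹ ^ (β + 1) with hq
  have hq1 : q < 1 := Real.rpow_lt_one (by norm_num) (by norm_num) hγ
  set w : ℕ → ℝ := fun n => (n : ℝ) ^ (β + 1) * L n with hw
  have hhalf : Tendsto (fun n : ℕ => n / 2) atTop atTop := Nat.tendsto_div_const_atTop two_ne_zero
  have hw0 : ∀ᶠ n in atTop, 0 < w n := by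
    filter_upwards [hL.eventually_pos, eventually_gt_atTop 0] with n h1 h2
    have : (0 : ℝ) < n := by exact_mod_cast h2
    positivity
  have hqn : Tendsto (fun n => w (n / 2) / w n) atTop (𝓝 q) := hL.tendsto_half_weight (β + 1)
  have hP := tendsto_sum_Ico_half_rpow_div hβ
  -- On the dyadic block `[n/2, n)` the ratio `L k / L n` is uniformly close to `1`, so `L` can be
  -- frozen at `n` and only a sum of powers remains.
  have hB : Tendsto (fun n => (∑ k ∈ Finset.Ico (n / 2) n, a k) / w n) atTop
      (𝓝 (c * ((1 - q) / (β + 1)))) := by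
    have hdiff : Tendsto (fun n => (∑ k ∈ Finset.Ico (n / 2) n, a k) / w n -
        c * ((∑ k ∈ Finset.Ico (n / 2) n, (k : ℝ) ^ β) / (n : ℝ) ^ (β + 1))) atTop (𝓝 0) := by
      rw [Metric.tendsto_nhds]
      intro ε hε
      -- An eventual upper bound for the normalized sum of powers: its limit plus `1`.
      set K := (1 - q) / (β + 1) + 1 with hK
      have hK0 : 0 < K := by
        have : 0 < 1 - q := by linarith
        positivity
      have hlim : Tendsto (fun z : ℝ × ℝ => z.1 * z.2) (𝓝 (c, 1)) (𝓝 c) := by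
        simpa using (continuous_mul (M := ℝ)).tendsto (c, 1)
      obtain ⟨η, hη, hmul⟩ := Metric.tendsto_nhds_nhds.mp hlim (ε / (2 * K)) (by positivity)
      obtain ⟨N₁, hN₁⟩ := Metric.tendsto_atTop.mp ha η hη
      obtain ⟨N₂, hN₂⟩ := hL.exists_forall_abs_div_sub_one_le (half_pos hη)
      obtain ⟨N₃, hN₃⟩ := eventually_atTop.mp hL.eventually_pos
      filter_upwards [hhalf.eventually_ge_atTop (max (max N₁ N₃) 1), eventually_ge_atTop (max N₂ 2),
        hP.eventually_le_const (lt_add_one _)] with n hn1 hn2 hn3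
      have hn0 : (0 : ℝ) < n := by
        have : 0 < n := by omega
        exact_mod_cast this
      have hLn : 0 < L n := hN₃ n (by omega)
      have hterm : ∀ k ∈ Finset.Ico (n / 2) n,
          |a k / w n - c * ((k : ℝ) ^ β / (n : ℝ) ^ (β + 1))| ≤
            ε / (2 * K) * ((k : ℝ) ^ β / (n : ℝ) ^ (β + 1)) := by
        intro k hk
        rw [Finset.mem_Ico] at hk
        have hk0 : (0 : ℝ) < k := by
          have : 0 < k := by omega
          exact_mod_cast this
        have hLk : 0 < L k := hN₃ k (by omega)
        have h1 := hN₁ k (by omega)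
        have h2 := hN₂ n k (by omega) (by omega) (by omega)
        have h3 := hmul (x := (a k / ((k : ℝ) ^ β * L k), L k / L n)) (by
          rw [Prod.dist_eq]
          refine max_lt h1 ?_
          rw [Real.dist_eq]
          linarith)
        rw [Real.dist_eq] at h3
        have hkβ := Real.rpow_pos_of_pos hk0 β
        have hnβ := Real.rpow_pos_of_pos hn0 (β + 1)
        have h4 : a k / w n - c * ((k : ℝ) ^ β / (n : ℝ) ^ (β + 1)) =
            (a k / ((k : ℝ) ^ β * L k) * (L k / L n) - c) *
              ((k : ℝ) ^ β / (n : ℝ) ^ (β + 1)) := by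
          simp only [hw]
          field_simp
        rw [h4, abs_mul, abs_of_pos (a := (k : ℝ) ^ β / (n : ℝ) ^ (β + 1)) (by positivity)]
        exact mul_le_mul_of_nonneg_right h3.le (by positivity)
      rw [Real.dist_eq, sub_zero, Finset.sum_div, Finset.sum_div, Finset.mul_sum,
        ← Finset.sum_sub_distrib]
      calc _ ≤ ∑ k ∈ Finset.Ico (n / 2) n, ε / (2 * K) * ((k : ℝ) ^ β / (n : ℝ) ^ (β + 1)) :=
            (Finset.abs_sum_le_sum_abs _ _).trans (Finset.sum_le_sum hterm)
        _ ≤ ε / (2 * K) * K := by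
            rw [← Finset.mul_sum, ← Finset.sum_div]
            exact mul_le_mul_of_nonneg_left hn3 (by positivity)
        _ = ε / 2 := by field_simp
        _ < ε := by linarith
    simpa using hdiff.add (hP.const_mul c)
  have hb : Tendsto (fun n => |(∑ k ∈ Finset.Ico (n / 2) n, a k) / w n -
      c / (β + 1) * (1 - w (n / 2) / w n)|) atTop (𝓝 0) := by
    have h1 := (hB.sub ((hqn.const_sub 1).const_mul (c / (β + 1)))).abs
    have h2 : c * ((1 - q) / (β + 1)) - c / (β + 1) * (1 - q) = 0 := by ring
    rwa [h2, abs_zero] at h1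
  -- Splitting the sum at `n / 2` gives a recursion for the error with contraction factor `w (n / 2)
  -- / w n → 2⁻¹ ^ (β + 1) < 1`.
  have hmain := tendsto_zero_of_le_mul_half_add
    (e := fun n => |(∑ k ∈ Finset.range n, a k) / w n - c / (β + 1)|) (fun n => abs_nonneg _)
    hqn hq1 hb (by
      filter_upwards [hw0, hhalf.eventually hw0] with n h1 h2
      have h3 : (∑ k ∈ Finset.range n, a k) / w n - c / (β + 1) =
          w (n / 2) / w n * ((∑ k ∈ Finset.range (n / 2), a k) / w (n / 2) - c / (β + 1)) +
          ((∑ k ∈ Finset.Ico (n / 2) n, a k) / w n - c / (β + 1) * (1 - w (n / 2) / w n)) := by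
        rw [Finset.sum_Ico_eq_sub _ (Nat.div_le_self n 2)]
        field_simp
        ring
      rw [h3]
      refine (abs_add_le _ _).trans (add_le_add_left (le_of_eq ?_) _)
      rw [abs_mul, abs_of_pos (div_pos h2 h1)])
  have h := ((tendsto_zero_iff_abs_tendsto_zero _).mpr hmain).add_const (c / (β + 1))
  simpa using h

/-- Halving the index changes the sequence by a factor with a known limit, so the halving recursion
applies with no additive term. -/
lemma tendsto_rpow_neg_mul (hL : IsSlowlyVarying L) {γ : ℝ} (hγ : 0 < γ) :
    Tendsto (fun n : ℕ => (n : ℝ) ^ (-γ) * L n) atTop (𝓝 0) := by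
  rw [tendsto_zero_iff_abs_tendsto_zero]
  have hhalf : Tendsto (fun n : ℕ => n / 2) atTop atTop := Nat.tendsto_div_const_atTop two_ne_zero
  have hq := (hL.tendsto_half_weight (-γ)).abs.inv₀ (by positivity)
  refine tendsto_zero_of_le_mul_half_add (fun n => abs_nonneg _) hq ?_
    (tendsto_const_nhds (x := (0 : ℝ))) ?_
  · rw [abs_of_pos (by positivity), ← Real.inv_rpow (by norm_num), inv_inv]
    exact Real.rpow_lt_one_of_one_lt_of_neg one_lt_two (neg_lt_zero.mpr hγ)
  · filter_upwards [hhalf.eventually hL.eventually_pos, hhalf.eventually_gt_atTop 0] with n h1 h2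
    have h3 : (0 : ℝ) < (n / 2 : ℕ) := by exact_mod_cast h2
    have h4 : 0 < ((n / 2 : ℕ) : ℝ) ^ (-γ) * L (n / 2 : ℕ) := by positivity
    simp only [Function.comp_apply]
    rw [add_zero, abs_div, inv_div, div_mul_cancel₀ _ (abs_pos.mpr h4.ne').ne']

lemma tendsto_rpow_mul_atTop (hL : IsSlowlyVarying L) {γ : ℝ} (hγ : 0 < γ) :
    Tendsto (fun n : ℕ => (n : ℝ) ^ γ * L n) atTop atTop := by
  have hhalf : Tendsto (fun n : ℕ => n / 2) atTop atTop := Nat.tendsto_div_const_atTop two_ne_zero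
  have hpos : ∀ᶠ n : ℕ in atTop, 0 < (n : ℝ) ^ γ * L n := by
    filter_upwards [hL.eventually_pos, eventually_gt_atTop 0] with n h1 h2
    have h3 : (0 : ℝ) < n := by exact_mod_cast h2
    positivity
  have h : Tendsto (fun n : ℕ => |((n : ℝ) ^ γ * L n)⁻¹|) atTop (𝓝 0) := by
    refine tendsto_zero_of_le_mul_half_add (fun n => abs_nonneg _) (hL.tendsto_half_weight γ)
      (Real.rpow_lt_one (by norm_num) (by norm_num) hγ) (tendsto_const_nhds (x := (0 : ℝ))) ?_
    filter_upwards [hpos, hhalf.eventually hpos] with n h1 h2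
    rw [add_zero, abs_of_pos (inv_pos.mpr h1), abs_of_pos (inv_pos.mpr h2), div_mul_eq_mul_div,
      mul_inv_cancel₀ h2.ne', one_div]
  have h5 := (tendsto_nhdsWithin_iff.mpr ⟨(tendsto_zero_iff_abs_tendsto_zero _).mpr h,
    hpos.mono fun n hn => Set.mem_Ioi.mpr (inv_pos.mpr hn)⟩).inv_tendsto_nhdsGT_zero
  exact h5.congr fun n => inv_inv _

/-- Needed because coordinates `a` and `b` of blocks at distance `n` are at lag `n + b - a`. -/
lemma tendsto_shift_weight (hL : IsSlowlyVarying L) (γ : ℝ) (a b : ℕ) :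
    Tendsto (fun n : ℕ => (((n + b - a : ℕ) : ℝ) ^ γ * L (n + b - a : ℕ)) / ((n : ℝ) ^ γ * L n))
      atTop (𝓝 1) := by
  have h1 := hL.tendsto_div_of_le (k := fun n => n + b - a)
    (by filter_upwards [eventually_ge_atTop b] with n hn; omega)
    (by filter_upwards [eventually_ge_atTop (2 * a)] with n hn; omega)
  have h2 : Tendsto (fun n : ℕ => ((n + b - a : ℕ) : ℝ) / n) atTop (𝓝 1) := by
    have h3 : Tendsto (fun n : ℕ => 1 + ((b : ℝ) - a) / n) atTop (𝓝 1) := by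
      simpa using (tendsto_const_div_atTop_nhds_zero_nat ((b : ℝ) - a)).const_add 1
    refine h3.congr' ?_
    filter_upwards [eventually_gt_atTop a] with n hn
    have hn0 : (n : ℝ) ≠ 0 := by
      have : n ≠ 0 := by omega
      exact_mod_cast this
    rw [Nat.cast_sub (by omega)]
    push_cast
    field_simp
    ring
  have h4 := (h2.rpow_const (p := γ) (Or.inl one_ne_zero)).mul h1
  rw [Real.one_rpow, mul_one] at h4
  refine h4.congr fun n => ?_
  rw [Real.div_rpow (by positivity) (by positivity), div_mul_div_comm]

end IsSlowlyVarying

/-! ### Variance asymptotics for stationary sums -/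

/-- Enlarging the square by one adds a row and a column sharing the corner `s 0`. The double sum
thus becomes an iterated one-index sum, ready for two uses of Karamata's theorem. -/
lemma sum_range_sum_range_dist (s : ℕ → ℝ) (n : ℕ) :
    ∑ i ∈ Finset.range n, ∑ j ∈ Finset.range n, s (Nat.dist i j) =
      ∑ m ∈ Finset.range n, (2 * ∑ k ∈ Finset.range m, s k + (2 * s m - s 0)) := by
  induction n with
  | zero => simp
  | succ n ih =>
    have h1 : ∑ i ∈ Finset.range n, s (Nat.dist i n) = ∑ k ∈ Finset.range n, s (k + 1) := by
      rw [← Finset.sum_range_reflect]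
      refine Finset.sum_congr rfl fun i hi => ?_
      have := Finset.mem_range.mp hi
      rw [Nat.dist_eq_sub_of_le (by omega)]
      congr 1
      omega
    have h2 : ∑ j ∈ Finset.range n, s (Nat.dist n j) = ∑ k ∈ Finset.range n, s (k + 1) := by
      simp_rw [Nat.dist_comm n, h1]
    have h3 : ∑ k ∈ Finset.range n, s (k + 1) + s 0 = ∑ k ∈ Finset.range n, s k + s n := by
      rw [← Finset.sum_range_succ', Finset.sum_range_succ]
    simp_rw [Finset.sum_range_succ]
    rw [Finset.sum_add_distrib, ih, h1, h2, Nat.dist_self]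
    linarith

/-- The variance of the partial sums of a stationary sequence whose covariances are asymptotic to
`c k ^ (-D) L k`. -/
lemma IsSlowlyVarying.tendsto_sum_sum_dist_div {L : ℝ → ℝ} (hL : IsSlowlyVarying L) {D c : ℝ}
    (hD0 : 0 < D) (hD1 : D < 1) {s : ℕ → ℝ}
    (hs : Tendsto (fun k : ℕ => s k / ((k : ℝ) ^ (-D) * L k)) atTop (𝓝 c)) :
    Tendsto (fun n : ℕ => (∑ i ∈ Finset.range n, ∑ j ∈ Finset.range n, s (Nat.dist i j)) /
      ((n : ℝ) ^ (2 - D) * L n)) atTop (𝓝 (2 / ((1 - D) * (2 - D)) * c)) := by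
  have h1 := hL.tendsto_sum_range_div (by linarith) hs
  -- This divergence, where `D < 1` matters, makes the bounded correction `2 * s m - s 0`
  -- negligible.
  have hinf := hL.tendsto_rpow_mul_atTop (γ := -D + 1) (by linarith)
  have hs0 : Tendsto s atTop (𝓝 0) := by
    have h2 := hs.mul (hL.tendsto_rpow_neg_mul hD0)
    rw [mul_zero] at h2
    refine h2.congr' ?_
    filter_upwards [hL.eventually_pos, eventually_gt_atTop 0] with n h3 h4
    have : (0 : ℝ) < n := by exact_mod_cast h4
    exact div_mul_cancel₀ _ (by positivity)
  have h2 : Tendsto (fun m : ℕ => (2 * s m - s 0) / ((m : ℝ) ^ (-D + 1) * L m)) atTop (𝓝 0) :=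
    ((hs0.const_mul 2).sub_const (s 0)).div_atTop hinf
  have h3 : Tendsto (fun m : ℕ => (2 * ∑ k ∈ Finset.range m, s k + (2 * s m - s 0)) /
      ((m : ℝ) ^ (-D + 1) * L m)) atTop (𝓝 (2 * (c / (-D + 1)))) := by
    have h4 := (h1.const_mul 2).add h2
    rw [add_zero] at h4
    exact h4.congr fun m => by ring
  -- The first summation contributed `1 / (1 - D)`; this one, at index `1 - D`, contributes `1 / (2
  -- - D)`.
  have h4 := hL.tendsto_sum_range_div (by linarith) h3
  have h5 : 2 * (c / (-D + 1)) / (-D + 1 + 1) = 2 / ((1 - D) * (2 - D)) * c := by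
    have : 1 - D ≠ 0 := by linarith
    have : 2 - D ≠ 0 := by linarith
    rw [show -D + 1 = 1 - D by ring, show 1 - D + 1 = 2 - D by ring]
    field_simp
  rw [h5, show -D + 1 + 1 = 2 - D by ring] at h4
  exact h4.congr fun n => by rw [sum_range_sum_range_dist]

/-! ### Linear independence of a decorrelating stationary sequence -/

open scoped InnerProductSpace in
/-- In a real inner product space, a stationary sequence of unit vectors whose correlations tend to
zero is linearly independent. -/
lemma linearIndependent_of_tendsto_inner_zero {H : Type*} [NormedAddCommGroup H]
    [InnerProductSpace ℝ H] {ξ : ℕ → H} {r : ℕ → ℝ} (hξ : ∀ i k, ⟪ξ i, ξ (i + k)⟫_ℝ = r k)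
    (hr0 : r 0 ≠ 0) (hr : Tendsto r atTop (𝓝 0)) (p : ℕ) :
    LinearIndependent ℝ (fun i : Fin p => ξ i) := by
  have hshift (i j m : ℕ) : ⟪ξ (i + m), ξ (j + m)⟫_ℝ = ⟪ξ i, ξ j⟫_ℝ := by
    rcases le_total i j with h | h
    · obtain ⟨k, rfl⟩ := Nat.exists_eq_add_of_le h
      rw [hξ, show i + k + m = i + m + k by ring, hξ]
    · obtain ⟨k, rfl⟩ := Nat.exists_eq_add_of_le h
      rw [real_inner_comm, real_inner_comm (ξ j), hξ, show j + k + m = j + m + k by ring, hξ]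
  induction p with
  | zero => exact linearIndependent_empty_type
  | succ p ih =>
    rw [linearIndependent_finSucc']
    refine ⟨by simpa [Fin.init_def] using ih, fun hmem => ?_⟩
    have hinit : Fin.init (fun i : Fin (p + 1) => ξ i) = fun i : Fin p => ξ i := by
      funext i
      simp [Fin.init]
    rw [hinit, Fin.val_last] at hmem
    set V := Submodule.span ℝ (Set.range fun i : Fin p => ξ i)
    obtain ⟨c, hc⟩ := (Submodule.mem_span_range_iff_exists_fun ℝ).mp hmem
    -- A linear relation holds exactly when a norm vanishes, and that norm depends only on
    -- shift-invariant inner products. The relation therefore propagates and confines every `ξ n` to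
    -- `V`.
    have hrec (m : ℕ) : ∑ i, c i • ξ (i + m) = ξ (p + m) := by
      rw [← sub_eq_zero, ← inner_self_eq_zero (𝕜 := ℝ)]
      have h0 : ⟪∑ i, c i • ξ i - ξ p, ∑ i, c i • ξ i - ξ p⟫_ℝ = 0 := by simp [hc]
      rw [← h0]
      simp only [inner_sub_left, inner_sub_right, sum_inner, inner_sum, real_inner_smul_left,
        real_inner_smul_right, hshift]
    have hV (n : ℕ) : ξ n ∈ V := by
      induction n using Nat.strong_induction_on with
      | _ n ihn =>
        rcases lt_or_ge n p with h | h
        · exact Submodule.subset_span ⟨⟨n, h⟩, rfl⟩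
        · obtain ⟨m, rfl⟩ := Nat.exists_eq_add_of_le h
          rw [← hrec m]
          exact Submodule.sum_mem _ fun i _ => Submodule.smul_mem _ _
            (ihn _ (by have := i.2; omega))
    have hweak (v : H) (hv : v ∈ V) : Tendsto (fun n => ⟪v, ξ n⟫_ℝ) atTop (𝓝 0) := by
      induction hv using Submodule.span_induction with
      | mem x hx =>
        obtain ⟨i, rfl⟩ := hx
        rw [← tendsto_add_atTop_iff_nat (i : ℕ)]
        refine hr.congr fun n => ?_
        rw [add_comm n, hξ]
      | zero => simp
      | add x y _ _ hx hy => simpa [inner_add_left] using hx.add hy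
      | smul a x _ hx => simpa [real_inner_smul_left] using hx.const_mul a
    have hfin : FiniteDimensional ℝ V := FiniteDimensional.span_of_finite ℝ (Set.finite_range _)
    -- Parseval in the finite-dimensional `V`: the finitely many coordinates tend to `0`, yet their
    -- squares sum to the constant `r 0 ≠ 0`.
    have hsum (n : ℕ) : ∑ i, ⟪((stdOrthonormalBasis ℝ V i : V) : H), ξ n⟫_ℝ ^ 2 = r 0 := by
      have h1 := (stdOrthonormalBasis ℝ V).sum_sq_norm_inner_right ⟨ξ n, hV n⟩
      have h2 := hξ n 0
      rw [add_zero, real_inner_self_eq_norm_sq] at h2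
      rw [← h2]
      simpa using h1
    have hlim : Tendsto (fun n => ∑ i, ⟪((stdOrthonormalBasis ℝ V i : V) : H), ξ n⟫_ℝ ^ 2) atTop
        (𝓝 0) := by
      have h := tendsto_finsetSum (Finset.univ) fun i _ =>
        ((hweak _ (stdOrthonormalBasis ℝ V i).2).pow 2)
      simpa using h
    simp_rw [hsum] at hlim
    exact hr0 (tendsto_nhds_unique tendsto_const_nhds hlim)

/-! ### Covariances and characteristic functions of Gaussian blocks -/

/-- The cross-covariance matrix of the blocks at `i` and `j`. -/
noncomputable def crossCov {Ω : Type*} [MeasurableSpace Ω] (X : ℕ → Ω → ℝ) (P : Measure Ω)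
    (p i j : ℕ) : Matrix (Fin p) (Fin p) ℝ :=
  Matrix.of fun k l => cov[X (i + k), X (j + l); P]

namespace IsStationaryStdGaussian

variable {Ω : Type*} [MeasurableSpace Ω] {P : Measure Ω} {X : ℕ → Ω → ℝ}

lemma memLp_two (hX : IsStationaryStdGaussian X P) (j : ℕ) : MemLp (X j) 2 P :=
  (hX.gaussian.hasGaussianLaw_eval j).memLp_two

lemma hasGaussianLaw_sum_mul (hX : IsStationaryStdGaussian X P) {S : Type*} [Fintype S]
    (c : S → ℝ) (τ : S → ℕ) : HasGaussianLaw (fun ω => ∑ s, c s * X (τ s) ω) P :=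
  ((hX.gaussian.comp_right τ).smul c).hasGaussianLaw_fun_sum (I := Finset.univ)

lemma memLp_dotProduct_block (hX : IsStationaryStdGaussian X P) {p : ℕ} (u : Fin p → ℝ) (i : ℕ) :
    MemLp (fun ω => u ⬝ᵥ block X p i ω) 2 P :=
  memLp_finsetSum _ fun k _ => (hX.memLp_two (i + k)).const_mul (u k)

lemma identDistrib_block (hX : IsStationaryStdGaussian X P) (p i : ℕ) :
    IdentDistrib (block X p i) (block X p 0) P P := by
  have h := (hX.stationary i).comp (u := fun x (k : Fin p) => x k) (by fun_prop)
  convert h using 1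
  · funext ω k
    simp [block, add_comm]
  · funext ω k
    simp [block]

lemma identDistrib_block_pair (hX : IsStationaryStdGaussian X P) (p i k : ℕ) :
    IdentDistrib (fun ω => (block X p i ω, block X p (i + k) ω))
      (fun ω => (block X p 0 ω, block X p k ω)) P P := by
  have h := (hX.stationary i).comp
    (u := fun x => ((fun l : Fin p => x l), (fun l : Fin p => x (k + l)))) (by fun_prop)
  convert h using 1
  · funext ω
    refine Prod.ext (funext fun l => ?_) (funext fun l => ?_)
    · simp [block, add_comm]
    · simp only [block, Function.comp_apply]
      congr 1
      omega
  · funext ω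
    refine Prod.ext (funext fun l => ?_) (funext fun l => ?_) <;> simp [block]

variable [IsProbabilityMeasure P]

lemma covariance_eq_integral (hX : IsStationaryStdGaussian X P) (i j : ℕ) :
    cov[X i, X j; P] = ∫ ω, X i ω * X j ω ∂P := by
  rw [covariance_eq_sub (hX.memLp_two i) (hX.memLp_two j), hX.mean_zero, zero_mul, sub_zero]
  rfl

lemma covariance_add (hX : IsStationaryStdGaussian X P) (i k : ℕ) :
    cov[X i, X (i + k); P] = cov[X 0, X k; P] := by
  rw [hX.covariance_eq_integral, hX.covariance_eq_integral]
  have h := ((hX.stationary i).comp (u := fun x => x 0 * x k) (by fun_prop)).integral_eq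
  simpa [Function.comp_def, add_comm] using h

lemma covariance_of_le (hX : IsStationaryStdGaussian X P) {i j : ℕ} (h : i ≤ j) :
    cov[X i, X j; P] = cov[X 0, X (j - i); P] := by
  rw [← hX.covariance_add i, Nat.add_sub_cancel' h]

lemma crossCov_self (hX : IsStationaryStdGaussian X P) (p i : ℕ) :
    crossCov X P p i i = blockCov X P p := by
  ext k l
  simp only [crossCov, blockCov, Matrix.of_apply]
  rcases le_total (k : ℕ) l with h | h
  · rw [hX.covariance_of_le (by omega), hX.covariance_of_le (i := 1 + k) (by omega)]
    congr 2
    omega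
  · rw [covariance_comm (X (i + k)), covariance_comm (X (1 + k)),
      hX.covariance_of_le (by omega), hX.covariance_of_le (i := 1 + l) (by omega)]
    congr 2
    omega

/-- The covariance matrix is the Gram matrix of the variables in L², which are linearly independent.
-/
lemma posDef_blockCov (hX : IsStationaryStdGaussian X P)
    (hr : Tendsto (fun k => cov[X 0, X k; P]) atTop (𝓝 0)) (p : ℕ) :
    (blockCov X P p).PosDef := by
  set ξ : ℕ → Lp ℝ 2 P := fun n => (hX.memLp_two n).toLp with hξ
  have hinner (i j : ℕ) : inner ℝ (ξ i) (ξ j) = cov[X i, X j; P] := by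
    rw [L2.inner_def, hX.covariance_eq_integral]
    refine integral_congr_ae ?_
    filter_upwards [(hX.memLp_two i).coeFn_toLp, (hX.memLp_two j).coeFn_toLp] with ω h1 h2
    rw [h1, h2]
    simp [mul_comm]
  have hli := linearIndependent_of_tendsto_inner_zero (ξ := ξ) (r := fun k => cov[X 0, X k; P])
    (fun i k => by rw [hinner, hX.covariance_add])
    (by rw [covariance_self (hX.memLp_two 0).aemeasurable, hX.var_one]; exact one_ne_zero) hr p
  have h := Matrix.posDef_gram_of_linearIndependent (𝕜 := ℝ) hli
  have h2 : Matrix.gram ℝ (fun i : Fin p => ξ i) = blockCov X P p := by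
    rw [← hX.crossCov_self p 0]
    ext k l
    simp [Matrix.gram_apply, hinner, crossCov]
  rwa [h2] at h

lemma integral_dotProduct_block (hX : IsStationaryStdGaussian X P) {p : ℕ} (u : Fin p → ℝ)
    (i : ℕ) : ∫ ω, u ⬝ᵥ block X p i ω ∂P = 0 := by
  simp only [dotProduct, block]
  rw [integral_finsetSum _ fun (k : Fin p) _ => ((hX.memLp_two (i + k)).integrable (by norm_num)).const_mul _]
  simp [integral_const_mul, hX.mean_zero]

lemma covariance_dotProduct_block (hX : IsStationaryStdGaussian X P) {p : ℕ} (u v : Fin p → ℝ)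
    (i j : ℕ) :
    cov[fun ω => u ⬝ᵥ block X p i ω, fun ω => v ⬝ᵥ block X p j ω; P] =
      u ⬝ᵥ (crossCov X P p i j).mulVec v := by
  simp only [dotProduct, Matrix.mulVec, block, crossCov, Matrix.of_apply]
  rw [covariance_fun_sum_fun_sum (fun k : Fin p => (hX.memLp_two (i + k)).const_mul (u k))
    (fun k : Fin p => (hX.memLp_two (j + k)).const_mul (v k))]
  simp only [covariance_const_mul_left, covariance_const_mul_right, Finset.mul_sum]
  exact Finset.sum_congr rfl fun k _ => Finset.sum_congr rfl fun l _ => by ring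

/-- The exponent involves a single centred Gaussian variable, so its variance determines the
integral. The minus sign matches the conjugation in the inner product of two characters. -/
lemma integral_exp_block_pair (hX : IsStationaryStdGaussian X P) {p : ℕ} (u v : Fin p → ℝ)
    (i j : ℕ) :
    ∫ ω, Complex.exp ((u ⬝ᵥ block X p i ω - v ⬝ᵥ block X p j ω : ℝ) * Complex.I) ∂P =
      Complex.exp ((-(u ⬝ᵥ (blockCov X P p).mulVec u) / 2 +
        -(v ⬝ᵥ (blockCov X P p).mulVec v) / 2 + u ⬝ᵥ (crossCov X P p i j).mulVec v : ℝ)) := by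
  set Z : Ω → ℝ := fun ω => u ⬝ᵥ block X p i ω - v ⬝ᵥ block X p j ω with hZ
  have hG : HasGaussianLaw Z P := by
    have h := hX.hasGaussianLaw_sum_mul (Sum.elim u (fun k => -v k))
      (Sum.elim (fun k : Fin p => i + k) (fun k : Fin p => j + k))
    simpa [Fintype.sum_sum_type, ← sub_eq_add_neg, dotProduct, block, hZ] using h
  have h0 : ∫ ω, Z ω ∂P = 0 := by
    rw [integral_sub ((hX.memLp_dotProduct_block u i).integrable (by norm_num))
      ((hX.memLp_dotProduct_block v j).integrable (by norm_num)), hX.integral_dotProduct_block,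
      hX.integral_dotProduct_block, sub_zero]
  have hV : Var[Z; P] = u ⬝ᵥ (blockCov X P p).mulVec u + v ⬝ᵥ (blockCov X P p).mulVec v -
      2 * (u ⬝ᵥ (crossCov X P p i j).mulVec v) := by
    rw [variance_fun_sub (hX.memLp_dotProduct_block u i) (hX.memLp_dotProduct_block v j),
      ← covariance_self (hX.memLp_dotProduct_block u i).aemeasurable,
      ← covariance_self (hX.memLp_dotProduct_block v j).aemeasurable,
      hX.covariance_dotProduct_block, hX.covariance_dotProduct_block,
      hX.covariance_dotProduct_block, hX.crossCov_self, hX.crossCov_self]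
    ring
  have h : charFun (P.map Z) 1 = 
      charFun (gaussianReal (∫ ω, Z ω ∂P) Var[Z; P].toNNReal) 1 := by rw [hG.map_eq_gaussianReal]
  rw [charFun_gaussianReal, charFun_apply_real, integral_map hG.aemeasurable (by fun_prop), h0,
    Real.coe_toNNReal _ (variance_nonneg _ _), hV] at h
  simp only [Complex.ofReal_one, one_mul] at h
  rw [h]
  congr 1
  push_cast
  ring

end IsStationaryStdGaussian

/-! ### Whitening and the quadratic covariance bound -/

open scoped ComplexOrder MatrixOrder Matrix in
/-- A positive definite real matrix can be whitened. -/
lemma Matrix.PosDef.exists_whitening {n : Type*} [Fintype n] [DecidableEq n] {S : Matrix n n ℝ}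
    (hS : S.PosDef) : ∃ M N : Matrix n n ℝ, N * M = 1 ∧ M * S * Mᵀ = 1 := by
  obtain ⟨y, hy, rfl⟩ := CStarAlgebra.isStrictlyPositive_iff_eq_star_mul_self.mp
    hS.isStrictlyPositive
  obtain ⟨u, rfl⟩ := hy
  refine ⟨(↑u⁻¹ : Matrix n n ℝ)ᵀ, (↑u : Matrix n n ℝ)ᵀ, ?_, ?_⟩
  · rw [← Matrix.transpose_mul, Units.inv_mul, Matrix.transpose_one]
  · rw [Matrix.star_eq_conjTranspose, Matrix.conjTranspose_eq_transpose_of_trivial,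
      Matrix.transpose_transpose, ← mul_assoc, ← Matrix.transpose_mul, Units.mul_inv,
      Matrix.transpose_one, one_mul, Units.mul_inv]

lemma Matrix.abs_mul_mul_transpose_apply_le {m n : Type*} [Fintype n] [Fintype m]
    (M : Matrix m n ℝ) (R : Matrix n n ℝ) {δ : ℝ} (hδ : 0 ≤ δ) (hR : ∀ i j, |R i j| ≤ δ) (i j : m) :
    |(M * R * M.transpose) i j| ≤ (∑ k, ∑ l, |M k l|) ^ 2 * δ := by
  have hrow (k : m) : ∑ l, |M k l| ≤ ∑ k, ∑ l, |M k l| :=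
    Finset.single_le_sum (f := fun k => ∑ l, |M k l|)
      (fun k _ => Finset.sum_nonneg fun l _ => abs_nonneg _) (Finset.mem_univ k)
  have h0 (k : m) : 0 ≤ ∑ l, |M k l| := Finset.sum_nonneg fun l _ => abs_nonneg _
  calc |(M * R * M.transpose) i j| = |∑ t, ∑ s, M i s * R s t * M j t| := by
        simp only [Matrix.mul_apply, Matrix.transpose_apply, Finset.sum_mul]
    _ ≤ ∑ t, ∑ s, |M i s| * δ * |M j t| := by
        refine (Finset.abs_sum_le_sum_abs _ _).trans (Finset.sum_le_sum fun t _ =>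
          (Finset.abs_sum_le_sum_abs _ _).trans (Finset.sum_le_sum fun s _ => ?_))
        rw [abs_mul, abs_mul]
        gcongr
        exact hR s t
    _ = (∑ s, |M i s|) * (∑ t, |M j t|) * δ := by
        rw [Finset.sum_mul_sum, Finset.sum_comm, Finset.sum_mul]
        refine Finset.sum_congr rfl fun s _ => ?_
        rw [Finset.sum_mul]
        exact Finset.sum_congr rfl fun t _ => by ring
    _ ≤ _ := by
        rw [sq]
        exact mul_le_mul_of_nonneg_right (mul_le_mul (hrow i) (hrow j) (h0 j)
          ((h0 i).trans (hrow i))) hδ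

namespace IsStationaryStdGaussian

variable {Ω : Type*} [MeasurableSpace Ω] {P : Measure Ω} [IsProbabilityMeasure P] {X : ℕ → Ω → ℝ}

/-- A function of Hermite rank at least two of a Gaussian block has covariances that are
quadratically small in the entries of the cross-covariance matrix. -/
lemma exists_abs_integral_mul_le (hX : IsStationaryStdGaussian X P) {p : ℕ}
    (hS : (blockCov X P p).PosDef) {g : (Fin p → ℝ) → ℝ} (hg : Measurable g)
    (hg2 : MemLp (fun ω => g (block X p 0 ω)) 2 P) (hg0 : ∫ ω, g (block X p 0 ω) ∂P = 0)
    (hg1 : ∀ k, ∫ ω, g (block X p 0 ω) * block X p 0 ω k ∂P = 0) :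
    ∃ C : ℝ, ∃ δ₀ > 0, ∀ (j : ℕ) (δ : ℝ), 0 ≤ δ → δ ≤ δ₀ →
      (∀ k l, |crossCov X P p 0 j k l| ≤ δ) →
      |∫ ω, g (block X p 0 ω) * g (block X p j ω) ∂P| ≤ C * δ ^ 2 := by
  obtain ⟨M, N, hNM, hM⟩ := hS.exists_whitening
  set m : ℝ := (∑ k, ∑ l, |M k l|) ^ 2 with hm
  have hm0 : 0 ≤ m := sq_nonneg _
  have hB (i : ℕ) : AEMeasurable (block X p i) P := (hX.identDistrib_block p i).aemeasurable_fst
  have hMm : Measurable fun x : Fin p → ℝ => M.mulVec x := by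
    refine measurable_pi_lambda _ fun k => ?_
    simp only [Matrix.mulVec, dotProduct]
    fun_prop
  have hNm : Measurable fun x : Fin p → ℝ => N.mulVec x := by
    refine measurable_pi_lambda _ fun k => ?_
    simp only [Matrix.mulVec, dotProduct]
    fun_prop
  have hW (i : ℕ) : AEMeasurable (fun ω => M.mulVec (block X p i ω)) P :=
    hMm.comp_aemeasurable (hB i)
  set μ := P.map (fun ω => M.mulVec (block X p 0 ω)) with hμ
  have : IsProbabilityMeasure μ := Measure.isProbabilityMeasure_map (hW 0)
  -- `g` in whitened coordinates; `N * M = 1` recovers `g` on the original blocks.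
  set g' : (Fin p → ℝ) → ℝ := fun x => g (N.mulVec x) with hg'
  have hg'm : Measurable g' := hg.comp hNm
  have hgW (i : ℕ) (ω : Ω) : g' (M.mulVec (block X p i ω)) = g (block X p i ω) := by
    simp [hg', hNM]
  have hg'2 : MemLp g' 2 μ := by
    rw [hμ, memLp_map_measure_iff hg'm.aestronglyMeasurable (hW 0)]
    exact hg2.congr_norm (hg'm.comp_aemeasurable (hW 0)).aestronglyMeasurable
      (ae_of_all _ fun ω => by simp [hgW])
  -- Whitening enlarges the bound on the entries of the cross-covariance by at most `m`. The
  -- threshold ensures `p m δ ≤ 1`, and the `+ 1` keeps it positive when `p m = 0`.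
  refine ⟨(p * m) ^ 2 * ∫ x, g' x ^ 2 ∂μ, (p * m + 1)⁻¹, by positivity, fun j δ hδ hδ0 hR => ?_⟩
  set κ := P.map (fun ω => (M.mulVec (block X p 0 ω), M.mulVec (block X p j ω))) with hκ
  have hWW : AEMeasurable (fun ω => (M.mulVec (block X p 0 ω), M.mulVec (block X p j ω))) P :=
    (hW 0).prodMk (hW j)
  have hfst : MeasurePreserving Prod.fst κ μ := by
    refine ⟨measurable_fst, ?_⟩
    rw [hκ, AEMeasurable.map_map_of_aemeasurable measurable_fst.aemeasurable hWW]
    rfl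
  have hsnd : MeasurePreserving Prod.snd κ μ := by
    refine ⟨measurable_snd, ?_⟩
    rw [hκ, AEMeasurable.map_map_of_aemeasurable measurable_snd.aemeasurable hWW]
    exact ((hX.identDistrib_block p j).comp hMm).map_eq
  have hb : (Fintype.card (Fin p) : ℝ) * (m * δ) ≤ 1 := by
    rw [Fintype.card_fin, ← mul_assoc]
    calc p * m * δ ≤ (p * m + 1) * (p * m + 1)⁻¹ := by gcongr; linarith
      _ = 1 := mul_inv_cancel₀ (by positivity)
  have h := abs_integral_mul_le_of_gaussian_pair hfst hsnd
    (M * crossCov X P p 0 j * M.transpose) (δ := m * δ) (by positivity)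
    (M.abs_mul_mul_transpose_apply_le _ hδ hR) hb (fun a b => ?_) (fun k => ?_) hg'2 ?_ (fun k => ?_)
  · rw [hκ, integral_map hWW (by
      exact ((hg'm.comp measurable_fst).mul (hg'm.comp measurable_snd)).aestronglyMeasurable)] at h
    simp only [hgW, Fintype.card_fin] at h
    calc _ ≤ _ := h
      _ = _ := by ring
  · have hcont : Continuous fun z : (Fin p → ℝ) × (Fin p → ℝ) =>
        Complex.exp ((a ⬝ᵥ z.1 - b ⬝ᵥ z.2 : ℝ) * Complex.I) := by
      simp only [dotProduct]
      fun_prop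
    rw [hκ, integral_map hWW hcont.aestronglyMeasurable]
    have h1 (u v : Fin p → ℝ) : u ⬝ᵥ M.mulVec v = (Matrix.vecMul u M) ⬝ᵥ v :=
      Matrix.dotProduct_mulVec _ _ _
    have h2 (R : Matrix (Fin p) (Fin p) ℝ) (u v : Fin p → ℝ) :
        Matrix.vecMul u M ⬝ᵥ R.mulVec (Matrix.vecMul v M) =
          u ⬝ᵥ (M * R * M.transpose).mulVec v := by
      rw [← Matrix.mulVec_mulVec, ← Matrix.mulVec_mulVec, h1, Matrix.mulVec_transpose]
    simp only [h1]
    rw [hX.integral_exp_block_pair, h2, h2, h2, hM, Matrix.one_mulVec, Matrix.one_mulVec]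
  · rw [hμ, memLp_map_measure_iff (measurable_pi_apply k).aestronglyMeasurable (hW 0)]
    exact hX.memLp_dotProduct_block (M k) 0
  · rw [hμ, integral_map (hW 0) hg'm.aestronglyMeasurable]
    simpa only [hgW] using hg0
  · rw [hμ, integral_map (hW 0) (by
      exact (hg'm.mul (measurable_pi_apply k)).aestronglyMeasurable)]
    simp only [hgW, Matrix.mulVec, dotProduct, Finset.mul_sum]
    rw [integral_finsetSum]
    · refine Finset.sum_eq_zero fun l _ => ?_
      simp_rw [mul_left_comm]
      rw [integral_const_mul, hg1, mul_zero]
    · intro l _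
      have := (hg2.integrable_mul (hX.memLp_two (0 + l))).const_mul (M k l)
      refine this.congr (ae_of_all _ fun ω => ?_)
      simp only [Pi.mul_apply, block]
      ring

end IsStationaryStdGaussian

/-! ### Convergence criteria and covariance asymptotics for block functions -/

lemma tendstoInMeasure_zero_of_tendsto_integral_sq {Ω : Type*} [MeasurableSpace Ω] {P : Measure Ω}
    {Z : ℕ → Ω → ℝ} (hZ : ∀ n, MemLp (Z n) 2 P)
    (h : Tendsto (fun n => ∫ ω, Z n ω ^ 2 ∂P) atTop (𝓝 0)) :
    TendstoInMeasure P Z atTop 0 := by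
  refine tendstoInMeasure_of_tendsto_eLpNorm (p := 2) two_ne_zero (fun n => (hZ n).1)
    aestronglyMeasurable_zero ?_
  have h1 (n : ℕ) : eLpNorm (Z n - 0) 2 P = ENNReal.ofReal ((∫ ω, Z n ω ^ 2 ∂P) ^ (2⁻¹ : ℝ)) := by
    rw [sub_zero, (hZ n).eLpNorm_eq_integral_rpow_norm two_ne_zero ENNReal.ofNat_ne_top]
    simp
  simp_rw [h1]
  have h2 := ENNReal.tendsto_ofReal (h.rpow_const (p := 2⁻¹) (Or.inr (by norm_num)))
  simpa using h2

/-- Centred Gaussian variables with converging variances converge in distribution. -/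
lemma tendstoInDistribution_of_hasGaussianLaw {Ω : Type*} [MeasurableSpace Ω] {P : Measure Ω}
    [IsProbabilityMeasure P] {Y : ℕ → Ω → ℝ} (hY : ∀ n, HasGaussianLaw (Y n) P)
    (hY0 : ∀ n, ∫ ω, Y n ω ∂P = 0) {v : ℝ}
    (hv : Tendsto (fun n => Var[Y n; P]) atTop (𝓝 v)) :
    TendstoInDistribution Y atTop (id : ℝ → ℝ) (fun _ => P) (gaussianReal 0 v.toNNReal) where
  forall_aemeasurable n := (hY n).aemeasurable
  aemeasurable_limit := aemeasurable_id
  tendsto := by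
    refine ProbabilityMeasure.tendsto_of_tendsto_charFun fun t => ?_
    have hv0 : 0 ≤ v := ge_of_tendsto' hv fun n => variance_nonneg _ _
    simp only [ProbabilityMeasure.coe_mk, Measure.map_id, (hY _).map_eq_gaussianReal, hY0,
      charFun_gaussianReal, Real.coe_toNNReal _ hv0, Real.coe_toNNReal _ (variance_nonneg _ _)]
    have hcont : Continuous fun x : ℝ => Complex.exp (t * (0 : ℝ) * Complex.I - x * t ^ 2 / 2) := by
      fun_prop
    exact (hcont.tendsto v).comp hv

lemma Finset.sum_Icc_one_eq_sum_range {M : Type*} [AddCommMonoid M] (F : ℕ → M) (n : ℕ) :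
    ∑ i ∈ Finset.Icc 1 n, F i = ∑ i ∈ Finset.range n, F (i + 1) := by
  induction n with
  | zero => simp
  | succ n ih => rw [Finset.sum_Icc_succ_top (by omega), Finset.sum_range_succ, ih]

namespace IsStationaryStdGaussian

variable {Ω : Type*} [MeasurableSpace Ω] {P : Measure Ω} {X : ℕ → Ω → ℝ}

lemma memLp_comp_block (hX : IsStationaryStdGaussian X P) {p : ℕ} {h : (Fin p → ℝ) → ℝ}
    (hh : Measurable h) {j : ℕ} (h2 : MemLp (fun ω => h (block X p j ω)) 2 P) (i : ℕ) :
    MemLp (fun ω => h (block X p i ω)) 2 P :=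
  (((hX.identDistrib_block p j).trans (hX.identDistrib_block p i).symm).comp hh).memLp_snd h2

lemma integral_mul_comp_block (hX : IsStationaryStdGaussian X P) {p : ℕ} {h : (Fin p → ℝ) → ℝ}
    (hh : Measurable h) (i j : ℕ) :
    ∫ ω, h (block X p i ω) * h (block X p j ω) ∂P =
      ∫ ω, h (block X p 0 ω) * h (block X p (Nat.dist i j) ω) ∂P := by
  have key (i k : ℕ) : ∫ ω, h (block X p i ω) * h (block X p (i + k) ω) ∂P =
      ∫ ω, h (block X p 0 ω) * h (block X p k ω) ∂P :=
    ((hX.identDistrib_block_pair p i k).comp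
      (u := fun z : (Fin p → ℝ) × (Fin p → ℝ) => h z.1 * h z.2) (by fun_prop)).integral_eq
  rcases le_total i j with hij | hij
  · rw [← key i, Nat.dist_eq_sub_of_le hij, Nat.add_sub_cancel' hij]
  · rw [← key j, Nat.dist_comm, Nat.dist_eq_sub_of_le hij, Nat.add_sub_cancel' hij]
    simp_rw [mul_comm]

lemma integral_sum_comp_block_sq (hX : IsStationaryStdGaussian X P) {p : ℕ}
    {h : (Fin p → ℝ) → ℝ} (hh : Measurable h) (h2 : MemLp (fun ω => h (block X p 0 ω)) 2 P)
    (n : ℕ) :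
    ∫ ω, (∑ i ∈ Finset.Icc 1 n, h (block X p i ω)) ^ 2 ∂P =
      ∑ i ∈ Finset.range n, ∑ j ∈ Finset.range n,
        ∫ ω, h (block X p 0 ω) * h (block X p (Nat.dist i j) ω) ∂P := by
  have hint (i j : ℕ) : Integrable (fun ω => h (block X p i ω) * h (block X p j ω)) P :=
    (hX.memLp_comp_block hh h2 i).integrable_mul (hX.memLp_comp_block hh h2 j)
  simp_rw [Finset.sum_Icc_one_eq_sum_range, sq, Finset.sum_mul_sum]
  rw [integral_finsetSum _ fun i _ => integrable_finsetSum _ fun j _ => hint _ _]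
  refine Finset.sum_congr rfl fun i _ => ?_
  rw [integral_finsetSum _ fun j _ => hint _ _]
  refine Finset.sum_congr rfl fun j _ => ?_
  rw [hX.integral_mul_comp_block hh, Nat.dist_add_add_right]

variable {D : ℝ} {L : ℝ → ℝ}

lemma tendsto_covariance_zero (hD0 : 0 < D) (hL : IsSlowlyVarying L)
    (hr : ∀ k : ℕ, 1 ≤ k → cov[X 0, X k; P] = L k * (k : ℝ) ^ (-D)) :
    Tendsto (fun k => cov[X 0, X k; P]) atTop (𝓝 0) := by
  refine (hL.tendsto_rpow_neg_mul hD0).congr' ?_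
  filter_upwards [eventually_ge_atTop 1] with k hk
  rw [hr k hk, mul_comm]

variable [IsProbabilityMeasure P]

lemma tendsto_crossCov_div (hX : IsStationaryStdGaussian X P) (hL : IsSlowlyVarying L)
    (hr : ∀ k : ℕ, 1 ≤ k → cov[X 0, X k; P] = L k * (k : ℝ) ^ (-D)) {p : ℕ} (a b : Fin p) :
    Tendsto (fun k : ℕ => crossCov X P p 0 k a b / ((k : ℝ) ^ (-D) * L k)) atTop (𝓝 1) := by
  refine (hL.tendsto_shift_weight (-D) a b).congr' ?_
  filter_upwards [eventually_gt_atTop (a : ℕ)] with k hk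
  rw [crossCov, Matrix.of_apply, zero_add, hX.covariance_of_le (by omega), hr _ (by omega),
    mul_comm (L _)]

lemma tendsto_sum_abs_crossCov_div (hX : IsStationaryStdGaussian X P) (hL : IsSlowlyVarying L)
    (hr : ∀ k : ℕ, 1 ≤ k → cov[X 0, X k; P] = L k * (k : ℝ) ^ (-D)) (p : ℕ) :
    Tendsto (fun k : ℕ => (∑ a, ∑ b, |crossCov X P p 0 k a b|) / ((k : ℝ) ^ (-D) * L k)) atTop
      (𝓝 (∑ _a : Fin p, ∑ _b : Fin p, 1)) := by
  have h := tendsto_finsetSum Finset.univ fun (a : Fin p) _ =>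
    tendsto_finsetSum Finset.univ fun (b : Fin p) _ => (hX.tendsto_crossCov_div hL hr a b).abs
  simp only [abs_one] at h
  refine h.congr' ?_
  filter_upwards [hL.eventually_pos, eventually_gt_atTop 0] with k h1 h2
  have h3 : (0 : ℝ) < k := by exact_mod_cast h2
  simp_rw [abs_div, abs_of_pos (show 0 < (k : ℝ) ^ (-D) * L k by positivity), Finset.sum_div]

/-- The covariances of a function of Hermite rank at least two are negligible. -/
lemma tendsto_integral_mul_div_zero (hX : IsStationaryStdGaussian X P) (hD0 : 0 < D)
    (hL : IsSlowlyVarying L)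
    (hr : ∀ k : ℕ, 1 ≤ k → cov[X 0, X k; P] = L k * (k : ℝ) ^ (-D)) {p : ℕ}
    {g : (Fin p → ℝ) → ℝ} (hg : Measurable g)
    (hg2 : MemLp (fun ω => g (block X p 0 ω)) 2 P) (hg0 : ∫ ω, g (block X p 0 ω) ∂P = 0)
    (hg1 : ∀ k, ∫ ω, g (block X p 0 ω) * block X p 0 ω k ∂P = 0) :
    Tendsto (fun k : ℕ => (∫ ω, g (block X p 0 ω) * g (block X p k ω) ∂P) /
      ((k : ℝ) ^ (-D) * L k)) atTop (𝓝 0) := by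
  obtain ⟨C, δ₀, hδ₀, hC⟩ := hX.exists_abs_integral_mul_le
    (hX.posDef_blockCov (tendsto_covariance_zero hD0 hL hr) p) hg hg2 hg0 hg1
  set δ : ℕ → ℝ := fun k => ∑ a, ∑ b, |crossCov X P p 0 k a b| with hδ
  set w : ℕ → ℝ := fun k => (k : ℝ) ^ (-D) * L k with hw
  have hw0 : ∀ᶠ k in atTop, 0 < w k := by
    filter_upwards [hL.eventually_pos, eventually_gt_atTop 0] with k h1 h2
    have h3 : (0 : ℝ) < k := by exact_mod_cast h2
    positivity
  have hδw : Tendsto (fun k => δ k / w k) atTop (𝓝 (∑ _a : Fin p, ∑ _b : Fin p, 1)) :=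
    hX.tendsto_sum_abs_crossCov_div hL hr p
  have hδ0 : Tendsto δ atTop (𝓝 0) := by
    have h := hδw.mul (hL.tendsto_rpow_neg_mul hD0)
    rw [mul_zero] at h
    refine h.congr' ?_
    filter_upwards [hw0] with k hk
    exact div_mul_cancel₀ _ hk.ne'
  -- The bound `C δ² / w` is `C δ (δ / w)`: one factor tends to `0`, the other stays bounded.
  have hlim := (hδ0.mul hδw).const_mul C
  rw [zero_mul, mul_zero] at hlim
  refine squeeze_zero_norm' ?_ hlim
  filter_upwards [hw0, hδ0.eventually_le_const hδ₀] with k h1 h2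
  have h3 := hC k (δ k)
    (Finset.sum_nonneg fun a _ => Finset.sum_nonneg fun b _ => abs_nonneg _) h2 fun a b =>
      (Finset.single_le_sum (f := fun b => |crossCov X P p 0 k a b|) (fun b _ => abs_nonneg _)
        (Finset.mem_univ b)).trans
      (Finset.single_le_sum (f := fun a => ∑ b, |crossCov X P p 0 k a b|)
        (fun a _ => Finset.sum_nonneg fun b _ => abs_nonneg _) (Finset.mem_univ a))
  rw [Real.norm_eq_abs, abs_div, abs_of_pos h1, ← mul_div_assoc, ← mul_div_assoc, ← sq]
  gcongr

lemma tendsto_integral_dotProduct_mul_div (hX : IsStationaryStdGaussian X P)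
    (hL : IsSlowlyVarying L)
    (hr : ∀ k : ℕ, 1 ≤ k → cov[X 0, X k; P] = L k * (k : ℝ) ^ (-D)) {p : ℕ} (u : Fin p → ℝ) :
    Tendsto (fun k : ℕ => (∫ ω, (u ⬝ᵥ block X p 0 ω) * (u ⬝ᵥ block X p k ω) ∂P) /
      ((k : ℝ) ^ (-D) * L k)) atTop (𝓝 ((∑ j, u j) ^ 2)) := by
  have h1 (k : ℕ) : ∫ ω, (u ⬝ᵥ block X p 0 ω) * (u ⬝ᵥ block X p k ω) ∂P =
      ∑ a, ∑ b, u a * u b * crossCov X P p 0 k a b := by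
    have h2 := covariance_eq_sub (hX.memLp_dotProduct_block u 0) (hX.memLp_dotProduct_block u k)
    rw [hX.covariance_dotProduct_block, hX.integral_dotProduct_block, zero_mul, sub_zero] at h2
    refine Eq.trans h2.symm ?_
    simp only [dotProduct, Matrix.mulVec, Finset.mul_sum]
    exact Finset.sum_congr rfl fun a _ => Finset.sum_congr rfl fun b _ => by ring
  have h := tendsto_finsetSum Finset.univ fun (a : Fin p) _ =>
    tendsto_finsetSum Finset.univ fun (b : Fin p) _ =>
      (hX.tendsto_crossCov_div hL hr a b).const_mul (u a * u b)
  simp only [mul_one, ← Finset.sum_mul_sum, ← sq] at h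
  refine h.congr fun k => ?_
  simp_rw [h1, Finset.sum_div, mul_div_assoc]

/-- Subtracting from `f` its mean and its linear part `α ⬝ᵥ x` leaves a function whose Hermite
coefficients of degree at most one vanish. -/
lemma integral_remainder (hX : IsStationaryStdGaussian X P) {p : ℕ} (hS : IsUnit (blockCov X P p))
    {f : (Fin p → ℝ) → ℝ} (hf : Measurable f)
    (hf2 : MemLp (fun ω => f (block X p 1 ω)) 2 P) :
    let g : (Fin p → ℝ) → ℝ := fun x => f x - ∫ ω, f (block X p 1 ω) ∂P - alphaVec X P f ⬝ᵥ x
    MemLp (fun ω => g (block X p 0 ω)) 2 P ∧ ∫ ω, g (block X p 0 ω) ∂P = 0 ∧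
      ∀ k, ∫ ω, g (block X p 0 ω) * block X p 0 ω k ∂P = 0 := by
  intro g
  set m := ∫ ω, f (block X p 1 ω) ∂P
  set α := alphaVec X P f with hα
  have hf0 := hX.memLp_comp_block hf hf2 0
  have hf1 : ∫ ω, f (block X p 0 ω) ∂P = m :=
    (((hX.identDistrib_block p 1).comp hf).integral_eq).symm
  have hlin := hX.memLp_dotProduct_block α 0
  have hX2 (k : Fin p) : MemLp (fun ω => block X p 0 ω k) 2 P := hX.memLp_two (0 + k)
  refine ⟨(hf0.sub (memLp_const m)).sub hlin, ?_, fun k => ?_⟩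
  · have hfi := hf0.integrable (q := 2) (by norm_num)
    have hfm : Integrable (fun ω => f (block X p 0 ω) - m) P := hfi.sub (integrable_const m)
    change ∫ ω, f (block X p 0 ω) - m - α ⬝ᵥ block X p 0 ω ∂P = 0
    rw [integral_sub hfm (hlin.integrable (by norm_num)),
      integral_sub hfi (integrable_const m), hf1, hX.integral_dotProduct_block]
    simp
  · have h1 : ∫ ω, f (block X p 0 ω) * block X p 0 ω k ∂P = firstOrderCoeff X P f k :=
      (((hX.identDistrib_block p 1).comp (u := fun x => f x * x k)
        (by fun_prop)).integral_eq).symm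
    have h2 : ∫ ω, (α ⬝ᵥ block X p 0 ω) * block X p 0 ω k ∂P = (blockCov X P p).mulVec α k := by
      simp only [dotProduct, Finset.sum_mul, Matrix.mulVec]
      have hint (l : Fin p) :
          Integrable (fun ω => α l * block X p 0 ω l * block X p 0 ω k) P :=
        ((hX2 l).const_mul (α l)).integrable_mul (hX2 k)
      rw [integral_finsetSum _ fun l _ => hint l]
      refine Finset.sum_congr rfl fun l _ => ?_
      rw [← hX.crossCov_self p 0, crossCov, Matrix.of_apply, hX.covariance_eq_integral,
        ← integral_mul_const]
      refine integral_congr_ae (ae_of_all _ fun ω => ?_)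
      simp only [block]
      ring
    have h3 : (blockCov X P p).mulVec α = firstOrderCoeff X P f := by
      rw [hα, alphaVec, Matrix.mulVec_mulVec,
        Matrix.mul_nonsing_inv _ ((Matrix.isUnit_iff_isUnit_det _).mp hS), Matrix.one_mulVec]
    have h4 : ∫ ω, block X p 0 ω k ∂P = 0 := hX.mean_zero (0 + k)
    simp only [g, sub_mul]
    rw [integral_sub, integral_sub, h1, h2, h3, integral_const_mul, h4]
    · simp
    · exact hf0.integrable_mul (hX2 k)
    · exact ((hX2 k).integrable (by norm_num)).const_mul m
    · exact (hf0.integrable_mul (hX2 k)).sub (((hX2 k).integrable (by norm_num)).const_mul m)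
    · exact hlin.integrable_mul (hX2 k)

end IsStationaryStdGaussian

/-! ### The limit theorem -/

lemma IsSlowlyVarying.eventually_normalizer_sq {L : ℝ → ℝ} (hL : IsSlowlyVarying L) (D : ℝ) :
    ∀ᶠ n : ℕ in atTop, ((n : ℝ) ^ (1 - D / 2) * √(L n)) ^ 2 = (n : ℝ) ^ (2 - D) * L n := by
  filter_upwards [hL.eventually_pos] with n hn
  rw [mul_pow, Real.sq_sqrt hn.le, ← Real.rpow_mul_natCast (by positivity)]
  congr 2
  push_cast
  ring

theorem mainTheorem4 {Ω : Type*} [MeasurableSpace Ω] (P : Measure Ω) [IsProbabilityMeasure P]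
    (X : ℕ → Ω → ℝ) (hX : IsStationaryStdGaussian X P)
    (D : ℝ) (hD0 : 0 < D) (hD1 : D < 1)
    (L : ℝ → ℝ) (hL : IsSlowlyVarying L)
    (hr : ∀ k : ℕ, 1 ≤ k → cov[X 0, X k; P] = L k * (k : ℝ) ^ (-D))
    (p : ℕ) (f : (Fin p → ℝ) → ℝ) (hf : Measurable f)
    (hf2 : MemLp (fun ω => f (block X p 1 ω)) 2 P)
    (hrank : hermiteRank f (P.map (block X p 1)) = 1) :
    IsUnit (blockCov X P p) ∧
      TendstoInDistribution (normalizedSum X P f L D) atTop (id : ℝ → ℝ) (fun _ => P)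
        (gaussianReal 0
          (Real.toNNReal (2 / ((1 - D) * (2 - D)) * (∑ j, alphaVec X P f j) ^ 2))) := by
  have hS : IsUnit (blockCov X P p) :=
    (hX.posDef_blockCov (IsStationaryStdGaussian.tendsto_covariance_zero hD0 hL hr) p).isUnit
  refine ⟨hS, ?_⟩
  set α := alphaVec X P f
  set m := ∫ ω, f (block X p 1 ω) ∂P with hm
  set a : ℕ → ℝ := fun n => (n : ℝ) ^ (1 - D / 2) * √(L n) with ha
  set g : (Fin p → ℝ) → ℝ := fun x => f x - m - α ⬝ᵥ x with hg
  obtain ⟨hg2, hg0, hg1⟩ := hX.integral_remainder hS hf hf2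
  have hlm : Measurable fun x : Fin p → ℝ => α ⬝ᵥ x := by
    simp only [dotProduct]
    fun_prop
  have hgm : Measurable g := (hf.sub_const m).sub hlm
  -- One second-moment computation serves both parts: `c = (∑ α_j)²` for the linear form and `c = 0`
  -- for `g`.
  have hsq {h : (Fin p → ℝ) → ℝ} (hh : Measurable h) (h2 : MemLp (fun ω => h (block X p 0 ω)) 2 P)
      {c : ℝ} (hc : Tendsto (fun k : ℕ => (∫ ω, h (block X p 0 ω) * h (block X p k ω) ∂P) /
        ((k : ℝ) ^ (-D) * L k)) atTop (𝓝 c)) :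
      Tendsto (fun n => ∫ ω, ((a n)⁻¹ * ∑ i ∈ Finset.Icc 1 n, h (block X p i ω)) ^ 2 ∂P) atTop
        (𝓝 (2 / ((1 - D) * (2 - D)) * c)) := by
    refine (hL.tendsto_sum_sum_dist_div hD0 hD1 hc).congr' ?_
    filter_upwards [hL.eventually_normalizer_sq D] with n hn
    simp_rw [mul_pow, integral_const_mul, hX.integral_sum_comp_block_sq hh h2, ha, inv_pow, hn]
    rw [div_eq_inv_mul]
  set Y : ℕ → Ω → ℝ := fun n ω => (a n)⁻¹ * ∑ i ∈ Finset.Icc 1 n, α ⬝ᵥ block X p i ω with hY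
  have hYL (n : ℕ) : HasGaussianLaw (Y n) P := by
    have h := hX.hasGaussianLaw_sum_mul (S := Finset.Icc 1 n × Fin p)
      (fun s => (a n)⁻¹ * α s.2) (fun s => s.1 + s.2)
    convert h using 1
    funext ω
    simp only [hY, Fintype.sum_prod_type, dotProduct, block, Finset.mul_sum, mul_assoc]
    exact (Finset.sum_coe_sort (Finset.Icc 1 n)
      (fun i => ∑ k : Fin p, (a n)⁻¹ * (α k * X (i + k) ω))).symm
  have hY0 (n : ℕ) : ∫ ω, Y n ω ∂P = 0 := by
    simp only [hY]
    rw [integral_const_mul, integral_finsetSum _ fun i _ =>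
      (hX.memLp_dotProduct_block α i).integrable (by norm_num)]
    simp [hX.integral_dotProduct_block]
  have hYlim : TendstoInDistribution Y atTop (id : ℝ → ℝ) (fun _ => P)
      (gaussianReal 0 (Real.toNNReal (2 / ((1 - D) * (2 - D)) * (∑ j, α j) ^ 2))) := by
    refine tendstoInDistribution_of_hasGaussianLaw hYL hY0 ?_
    simp_rw [variance_of_integral_eq_zero (hYL _).aemeasurable (hY0 _)]
    exact hsq hlm (hX.memLp_dotProduct_block α 0)
      (hX.tendsto_integral_dotProduct_mul_div hL hr α)
  have hdiff : normalizedSum X P f L D - Y =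
      fun n ω => (a n)⁻¹ * ∑ i ∈ Finset.Icc 1 n, g (block X p i ω) := by
    funext n ω
    simp only [Pi.sub_apply, normalizedSum, hY, hg, ← mul_sub, ← Finset.sum_sub_distrib, ha, hm]
  -- Slutsky's theorem: the difference from the Gaussian sums `Y` tends to `0` in L², hence in
  -- probability.
  refine tendstoInDistribution_of_tendstoInMeasure_sub _ _ hYlim ?_ fun n => ?_
  · rw [hdiff]
    refine tendstoInMeasure_zero_of_tendsto_integral_sq (fun n => ?_) ?_
    · exact (memLp_finsetSum _ fun i _ => hX.memLp_comp_block hgm hg2 i).const_mul _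
    · simpa using hsq hgm hg2
        (hX.tendsto_integral_mul_div_zero hD0 hL hr hgm hg2 hg0 hg1)
  · refine AEMeasurable.const_mul (Finset.aemeasurable_fun_sum _ fun i _ => ?_) _
    exact (hf.comp_aemeasurable (hX.identDistrib_block p i).aemeasurable_fst).sub_const _
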